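/- Let $\kappa$ be either an infinite regular cardinal or the symbol $\infty$, which is greater than every cardinal and ordinal. Write $\mathcal{P}_{<\kappa}X$ for the set of subsets of $X$ of size less than $\kappa$, so $\mathcal{P}_{<\infty}=\mathcal{P}$ is the full powerset functor. Throughout, $0$ counts as a limit ordinal. *Systems.* A pointed system is a set with a binary relation $\rightsquigarrow$ and a distinguished element $x$ (we write $x$ for the system); $y$ is a successor of $x$ if $x\rightsquigarrow y$. It is ${<}\kappa$-branching if every element reachable from $x$ (by finitely many, possibly zero, steps) has fewer than $\kappa$ successors. For ordinals $i$ the relations $\sim_i$ between pointed systems are: $x\sim_{i+1}x'$ iff every successor of $x$ is $\sim_i$ to some successor of $x'$ and every successor of $x'$ is $\sim_i$-related to some successor of $x$; for $i$ a limit, $x\sim_i x'$ iff $x\sim_j x'$ for all $j<i$. *Final chain.* The final chain of $\mathcal{P}_{<\kappa}$ consists of sets $\nu_i\mathcal{P}_{<\kappa}$ and connecting maps $\nu^j_i:\nu_i\mathcal{P}_{<\kappa}\to\nu_j\mathcal{P}_{<\kappa}$ for ordinals $j\le i$, functorial in the sense that $\nu^i_i=\mathrm{id}$ and $\nu^k_j\nu^j_i=\nu^k_i$,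 with $\nu_{i+1}\mathcal{P}_{<\kappa}=\mathcal{P}_{<\kappa}(\nu_i\mathcal{P}_{<\kappa})$, $\nu^{j+1}_{i+1}a=\{\nu^j_i b\mid b\in a\}$, and, for $i$ a limit, $\nu_i\mathcal{P}_{<\kappa}$ the set of families $(a_j)_{j<i}$ with $a_j\in\nu_j\mathcal{P}_{<\kappa}$ and $\nu^k_j a_j=a_k$ for $k\le j<i$, with $\nu^j_i(a)=a_j$ for $j<i$. For a ${<}\kappa$-branching pointed system $x$, the projection $p_i(x)\in\nu_i\mathcal{P}_{<\kappa}$ is given by $p_{i+1}(x)=\{p_i(y)\mid x\rightsquigarrow y\}$ and, for $i$ a limit, $p_i(x)=(p_j(x))_{j<i}$. We have $\nu_i\mathcal{P}_{<\kappa}\subseteq\nu_i\mathcal{P}$, and elements $a\in\nu_i\mathcal{P}_{<\kappa}$ are regarded as pointed systems inside the transition system formed by the final chain of $\mathcal{P}$: the successors of $a\in\nu_{i+1}\mathcal{P}$ are the $b\in\nu_i\mathcal{P}$ with $b\in a$, and, for $i$ a limit, the successors of $a\in\nu_i\mathcal{P}$ are the $b\in\nu_i\mathcal{P}$ with $b_j\in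 a_{j+1}$ for all $j<i$. *Extensible ordinals.* For a regular infinite cardinal $\lambda$, a tidy $\lambda$-tree is a family of sets $(D_i)_{i<\lambda}$ with functorial connecting maps $D_i\to D_j$ ($j\le i<\lambda$) that are all surjective, such that for each limit $i<\lambda$ an element of $D_i$ is determined by its images in the $D_j$, $j<i$, and such that $D_0\neq\emptyset$ (so $D_0$ is a singleton); a full branch is a family $(x_i)_{i<\lambda}$, $x_i\in D_i$, compatible with the connecting maps. $\lambda$ has the tree property if every tidy $\lambda$-tree with $|D_i|<\lambda$ for all $i<\lambda$ has a full branch. $\lambda$ is weakly compact if it has the tree property and $2^{\mu}<\lambda$ for all cardinals $\mu<\lambda$ (so $\aleph_0$ is weakly compact). An ordinal is $\omega$-cofinal if it is the supremum of a strictly increasing sequence $(i_n)_{n\in\mathbb{N}}$. The $\kappa$-extensible limit ordinals are: $0$; any $\omega$-cofinal ordinal; any weakly compact cardinal; if $\kappa<\infty$, any limit ordinal $\ge\kappa+\omega$; and $\kappa$ itself, if $\kappa<\infty$ and $\kappa$ has the tree property. Every ordinal is uniquely $i=i'+m$ with $i'$ a limit and $m\in\mathbb{N}$; $i'$ is its limit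 part and $m$ its finite part. **Proposition 7.15.** 1. For any ordinal $j$, the following are equivalent. (a) For every ${<}\kappa$-branching pointed system $x$, any $b\in\nu_j\mathcal{P}_{<\kappa}$ with $b\sim_j x$ is equal to $p_j(x)$. (b) For every ${<}\kappa$-branching pointed system $x$, $p_j(x)$ is the unique $b\in\nu_j\mathcal{P}_{<\kappa}$ with $b\sim_j x$ (that is, $p_j(x)\sim_j x$ and no other $b$ satisfies $b\sim_j x$). (c) The limit part of $j$ is $\kappa$-extensible. 2. For any ordinals $j\le i$, the following are equivalent. (a) For every $a\in\nu_i\mathcal{P}_{<\kappa}$, any $b\in\nu_j\mathcal{P}_{<\kappa}$ with $b\sim_j a$ is equal to $\nu^j_i a$. (b) For every $a\in\nu_i\mathcal{P}_{<\kappa}$, $\nu^j_i a$ is the unique $b\in\nu_j\mathcal{P}_{<\kappa}$ with $b\sim_j a$ (that is, $\nu^j_i a\sim_j a$ and no other $b$ satisfies $b\sim_j a$). (c) Either $j$ is at most the finite part of $i$, or the limit parts of both $j$ and $i$ are $\kappa$-extensible. -/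

import Mathlib

open Order

universe u v w

namespace GhostChain

/-! ## Sizes -/

/-- The set `s` is `<κ`-sized. Here `κ` is a cardinal, or the symbol `⊤`, which is greater than
every cardinal and therefore imposes no restriction. -/
def SizeLT (κ : WithTop Cardinal.{u}) {X : Type v} (s : Set X) : Prop :=
  ∀ c : Cardinal.{u}, κ = (c : WithTop Cardinal.{u}) →
    Cardinal.lift.{u} (Cardinal.mk s) < Cardinal.lift.{v} c

theorem SizeLT.image {κ : WithTop Cardinal.{u}} {X : Type v} {Y : Type w} {s : Set X}
    (hs : SizeLT κ s) (f : X → Y) : SizeLT κ (f '' s) := by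
  intro c hc
  have h1 := Cardinal.lift_le.{u}.2 (Cardinal.mk_image_le_lift (f := f) (s := s))
  have h2 := Cardinal.lift_lt.{_, w}.2 (hs c hc)
  rw [← Cardinal.lift_lt.{_, v}]
  simp only [Cardinal.lift_lift] at h1 h2 ⊢
  exact h1.trans_lt h2

/-! ## Pointed systems and the approximants to bisimilarity -/

/-- A pointed system: a transition system together with one of its elements. -/
structure PointedSystem : Type (v + 1) where
  carrier : Type v
  step : carrier → carrier → Prop
  pt : carrier

/-- The approximants `∼ᵢ` to bisimilarity, between elements of two transition systems. The
ordinal `0` is treated as a limit, so `∼₀` always holds. -/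
noncomputable def Approx {X : Type v} {Y : Type w} (r : X → X → Prop) (s : Y → Y → Prop)
    (i : Ordinal.{u}) : X → Y → Prop :=
  SuccOrder.prelimitRecOn (motive := fun _ => X → Y → Prop) i
    (fun _ _ sim x x' => (∀ y, r x y → ∃ y', s x' y' ∧ sim y y') ∧
      (∀ y', s x' y' → ∃ y, r x y ∧ sim y y'))
    (fun i _ sim x x' => ∀ (j : Ordinal.{u}) (hj : j < i), sim j hj x x')

theorem approx_succ {X : Type v} {Y : Type w} (r : X → X → Prop) (s : Y → Y → Prop)
    (i : Ordinal.{u}) (x : X) (x' : Y) : Approx r s (succ i) x x' ↔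
      (∀ y, r x y → ∃ y', s x' y' ∧ Approx r s i y y') ∧
      (∀ y', s x' y' → ∃ y, r x y ∧ Approx r s i y y') := by
  rw [Approx, SuccOrder.prelimitRecOn_succ]; rfl

theorem approx_limit {X : Type v} {Y : Type w} (r : X → X → Prop) (s : Y → Y → Prop)
    {i : Ordinal.{u}} (hi : IsSuccPrelimit i) (x : X) (x' : Y) :
    Approx r s i x x' ↔ ∀ j < i, Approx r s j x x' := by
  rw [Approx, SuccOrder.prelimitRecOn_of_isSuccPrelimit _ _ hi]; rfl

/-- The relation `x ∼ᵢ y` between pointed systems. -/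
def PointedSystem.Sim (i : Ordinal.{u}) (x : PointedSystem.{v}) (y : PointedSystem.{w}) : Prop :=
  Approx x.step y.step i x.pt y.pt

/-- A pointed system is `<κ`-branching when every element reachable from its point has
`<κ`-many successors. -/
def PointedSystem.Branching (κ : WithTop Cardinal.{u}) (x : PointedSystem.{v}) : Prop :=
  ∀ y, Relation.ReflTransGen x.step x.pt y → SizeLT κ {z | x.step y z}

/-! ## Inverse chains -/

/-- An inverse `I`-chain: a contravariant functor from the order `I` to sets. -/
structure InverseChain (I : Type v) [Preorder I] where
  level : I → Type w
  map : ∀ {j i : I}, j ≤ i → level i → level j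
  map_id : ∀ (i : I) (x : level i), map (le_refl i) x = x
  map_comp : ∀ {k j i : I} (hkj : k ≤ j) (hji : j ≤ i) (x : level i),
    map hkj (map hji x) = map (hkj.trans hji) x

/-- `D` has a full branch. -/
def InverseChain.HasFullBranch {I : Type v} [Preorder I] (D : InverseChain.{v, w} I) : Prop :=
  ∃ x : ∀ i, D.level i, ∀ (j i : I) (h : j ≤ i), D.map h (x i) = x j

/-- An inverse chain on a well-ordered set is a tidy tree when all connecting maps are surjective,
at each limit index a full branch through the lower levels has at most one extension (the least
index counts as a limit), and there is a root. -/
structure InverseChain.IsTidyTree {I : Type v} [LinearOrder I] (D : InverseChain.{v, w} I) :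
    Prop where
  surj : ∀ (j i : I) (h : j ≤ i), Function.Surjective (D.map h)
  limit : ∀ i : I, IsSuccPrelimit i → ∀ x y : D.level i,
    (∀ (j : I) (h : j < i), D.map h.le x = D.map h.le y) → x = y
  root : ∃ i : I, IsBot i ∧ Nonempty (D.level i)

/-! ## Extensible ordinals -/

/-- The tree property of a (regular infinite) cardinal `c`: every tidy `c`-tree with all levels
`<c`-sized has a full branch. -/
def TreeProperty (c : Cardinal.{u}) : Prop :=
  ∀ D : InverseChain.{u + 1, u} (Set.Iio c.ord), D.IsTidyTree →
    (∀ i, Cardinal.mk (D.level i) < c) → D.HasFullBranch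

/-- Weakly compact cardinals; `ℵ₀` is included. -/
structure WeaklyCompact (c : Cardinal.{u}) : Prop where
  regular : c.IsRegular
  inaccessible : ∀ A : Type u, Cardinal.mk A < c → Cardinal.mk (Set A) < c
  treeProperty : TreeProperty c

/-- `i` is the supremum of a strictly increasing sequence of ordinals. -/
def OmegaCofinal (i : Ordinal.{u}) : Prop :=
  ∃ f : ℕ → Ordinal.{u}, StrictMono f ∧ IsLUB (Set.range f) i

/-- The `κ`-extensible limit ordinals, where `κ` is regular infinite or `⊤`. -/
def Extensible (κ : WithTop Cardinal.{u}) (i : Ordinal.{u}) : Prop :=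
  i = 0 ∨
  OmegaCofinal i ∨
  (∃ c : Cardinal.{u}, WeaklyCompact c ∧ i = c.ord) ∨
  (∃ c : Cardinal.{u}, κ = (c : WithTop Cardinal.{u}) ∧
    IsSuccLimit i ∧ c.ord + Ordinal.omega0 ≤ i) ∨
  (∃ c : Cardinal.{u}, κ = (c : WithTop Cardinal.{u}) ∧ i = c.ord ∧ TreeProperty c)

/-- The limit part of an ordinal. -/
noncomputable def limitPart (i : Ordinal.{u}) : Ordinal.{u} :=
  Ordinal.omega0 * (i / Ordinal.omega0)

/-- The finite part of an ordinal. -/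
noncomputable def finitePart (i : Ordinal.{u}) : Ordinal.{u} := i % Ordinal.omega0

/-- `limitPart` and `finitePart` are the components of the unique decomposition of an ordinal as
the sum of a limit (possibly `0`) and a natural number. -/
theorem eq_add_natCast_iff (i l : Ordinal.{u}) (m : ℕ) :
    (IsSuccPrelimit l ∧ i = l + (m : Ordinal.{u})) ↔
      (limitPart i = l ∧ finitePart i = (m : Ordinal.{u})) := by
  have hm : (m : Ordinal.{u}) < Ordinal.omega0 := Ordinal.natCast_lt_omega0 m
  constructor
  · rintro ⟨hl, rfl⟩
    obtain ⟨q, rfl⟩ := Ordinal.isSuccPrelimit_iff_omega0_dvd.1 hl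
    rw [limitPart, finitePart, Ordinal.mul_add_div _ Ordinal.omega0_ne_zero,
      Ordinal.mul_add_mod_self, Ordinal.div_eq_zero_of_lt hm, Ordinal.mod_eq_of_lt hm, add_zero]
    exact ⟨rfl, rfl⟩
  · rintro ⟨rfl, h⟩
    refine ⟨Ordinal.isSuccPrelimit_iff_omega0_dvd.2 ⟨_, rfl⟩, ?_⟩
    rw [← h, limitPart, finitePart, Ordinal.div_add_mod]

/-! ## The raw levels

The `i`-th level of the final chain of the powerset functor (and of its subfunctors) is carved out
of a larger set `Raw i`, in which tuples at limit levels need not be compatible: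
`Raw (i + 1)` is the powerset of `Raw i`, and if `i` is a limit (or `0`) then `Raw i` is the
product of all `Raw j` for `j < i`.

"Sets" are the types in `Type u`, and ordinals and cardinals are those of universe `u`. Each
`Raw i` is small (equivalent to a type in `Type u`), by induction; it is placed in `Type (u + 1)`
only because the index sets `{j | j < i}` are. -/

noncomputable def Raw (i : Ordinal.{u}) : Type (u + 1) :=
  SuccOrder.prelimitRecOn (motive := fun _ => Type (u + 1)) i
    (fun _ _ T => Set T)
    (fun i _ T => ∀ (j : Ordinal.{u}) (hj : j < i), T j hj)

/-- `Raw (i + 1)` is the powerset of `Raw i`. -/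
noncomputable def succEquiv (i : Ordinal.{u}) : Raw (succ i) ≃ Set (Raw i) :=
  Equiv.cast (by rw [Raw, SuccOrder.prelimitRecOn_succ]; rfl)

/-- For a limit `i` (or `i = 0`), `Raw i` is the product of the lower levels. -/
noncomputable def limEquiv {i : Ordinal.{u}} (hi : IsSuccPrelimit i) :
    Raw i ≃ (∀ j : Ordinal.{u}, j < i → Raw j) :=
  Equiv.cast (by rw [Raw, SuccOrder.prelimitRecOn_of_isSuccPrelimit _ _ hi]; rfl)

/-- The connecting maps on raw elements, by recursion on the upper index `i`:
* if `i` is a limit, then the map to level `j < i` is the `j`-th projection;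
* the map from level `i + 1` to level `j + 1` is the direct image along the map from level `i` to
  level `j`;
* the map from level `i + 1` to a limit level `j ≤ i + 1` is the tuple of all maps to lower
  levels `k < j`. -/
noncomputable def rawConn (i : Ordinal.{u}) : ∀ j : Ordinal.{u}, j ≤ i → Raw i → Raw j :=
  SuccOrder.prelimitRecOn
    (motive := fun i : Ordinal.{u} => ∀ j : Ordinal.{u}, j ≤ i → Raw i → Raw j) i
    (fun i _ conn j =>
      SuccOrder.prelimitRecOn
        (motive := fun j : Ordinal.{u} => j ≤ succ i → Raw (succ i) → Raw j) j
        (fun j _ _ h a => (succEquiv j).symm (conn j (succ_le_succ_iff.1 h) '' succEquiv i a))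
        (fun _ hj conn' h a => (limEquiv hj).symm fun k hk => conn' k hk (hk.le.trans h) a))
    (fun i hi _ j h a =>
      if hlt : j < i then limEquiv hi a j hlt else (le_antisymm h (not_lt.1 hlt)) ▸ a)

theorem rawConn_succ_succ {i j : Ordinal.{u}} (h : succ j ≤ succ i) (a : Raw (succ i)) :
    rawConn (succ i) (succ j) h a =
      (succEquiv j).symm (rawConn i j (succ_le_succ_iff.1 h) '' succEquiv i a) := by
  rw [rawConn, SuccOrder.prelimitRecOn_succ, SuccOrder.prelimitRecOn_succ]; rfl

theorem rawConn_succ_limit {i j : Ordinal.{u}} (hj : IsSuccPrelimit j) (h : j ≤ succ i)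
    (a : Raw (succ i)) :
    rawConn (succ i) j h a =
      (limEquiv hj).symm fun k hk => rawConn (succ i) k (hk.le.trans h) a := by
  rw [rawConn, SuccOrder.prelimitRecOn_succ,
    SuccOrder.prelimitRecOn_of_isSuccPrelimit _ _ hj]

theorem rawConn_limit {i j : Ordinal.{u}} (hi : IsSuccPrelimit i) (h : j < i) (a : Raw i) :
    rawConn i j h.le a = limEquiv hi a j h := by
  rw [rawConn, SuccOrder.prelimitRecOn_of_isSuccPrelimit _ _ hi, dif_pos h]

theorem rawConn_self (i : Ordinal.{u}) (a : Raw i) : rawConn i i le_rfl a = a := by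
  induction i using SuccOrder.prelimitRecOn with
  | succ i _ ih =>
    rw [rawConn_succ_succ]
    have : rawConn i i le_rfl = id := funext ih
    rw [this, Set.image_id, Equiv.symm_apply_apply]
  | isSuccPrelimit i hi _ =>
    rw [rawConn, SuccOrder.prelimitRecOn_of_isSuccPrelimit _ _ hi, dif_neg (lt_irrefl i)]

/-! ## The final chain -/

/-- The raw elements that belong to the `i`-th level of the final chain of `𝒫_{<κ}`:
* at `i + 1`, the `<κ`-sized sets of elements of the `i`-th level;
* at a limit (or `0`), the full branches through the lower levels. -/
noncomputable def IsElement (κ : WithTop Cardinal.{u}) (i : Ordinal.{u}) : Raw i → Prop :=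
  SuccOrder.prelimitRecOn (motive := fun i : Ordinal.{u} => Raw i → Prop) i
    (fun i _ P a => SizeLT κ (succEquiv i a) ∧ ∀ b ∈ succEquiv i a, P b)
    (fun i hi P a => (∀ (j : Ordinal.{u}) (hj : j < i), P j hj (limEquiv hi a j hj)) ∧
      ∀ (k j : Ordinal.{u}) (hkj : k ≤ j) (hj : j < i),
        rawConn j k hkj (limEquiv hi a j hj) = limEquiv hi a k (hkj.trans_lt hj))

theorem isElement_succ {κ : WithTop Cardinal.{u}} {i : Ordinal.{u}} {a : Raw (succ i)} :
    IsElement κ (succ i) a ↔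
      SizeLT κ (succEquiv i a) ∧ ∀ b ∈ succEquiv i a, IsElement κ i b := by
  rw [IsElement, SuccOrder.prelimitRecOn_succ]; rfl

theorem isElement_limit {κ : WithTop Cardinal.{u}} {i : Ordinal.{u}} (hi : IsSuccPrelimit i)
    {a : Raw i} :
    IsElement κ i a ↔
      (∀ (j : Ordinal.{u}) (hj : j < i), IsElement κ j (limEquiv hi a j hj)) ∧
      ∀ (k j : Ordinal.{u}) (hkj : k ≤ j) (hj : j < i),
        rawConn j k hkj (limEquiv hi a j hj) = limEquiv hi a k (hkj.trans_lt hj) := by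
  rw [IsElement, SuccOrder.prelimitRecOn_of_isSuccPrelimit _ _ hi]; rfl

theorem IsElement.top {κ : WithTop Cardinal.{u}} {i : Ordinal.{u}} {a : Raw i}
    (h : IsElement κ i a) : IsElement (⊤ : WithTop Cardinal.{u}) i a := by
  induction i using SuccOrder.prelimitRecOn with
  | succ i _ ih =>
    rw [isElement_succ] at h ⊢
    exact ⟨fun c hc => absurd hc (WithTop.top_ne_coe), fun b hb => ih (h.2 b hb)⟩
  | isSuccPrelimit i hi ih =>
    rw [isElement_limit hi] at h ⊢
    exact ⟨fun j hj => ih j hj (h.1 j hj), h.2⟩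

theorem isElement_rawConn_and {κ : WithTop Cardinal.{u}} (i : Ordinal.{u}) :
    ∀ a : Raw i, IsElement κ i a →
      (∀ (k j : Ordinal.{u}) (hkj : k ≤ j) (hji : j ≤ i),
        rawConn j k hkj (rawConn i j hji a) = rawConn i k (hkj.trans hji) a) ∧
      (∀ (j : Ordinal.{u}) (hji : j ≤ i), IsElement κ j (rawConn i j hji a)) := by
  induction i using SuccOrder.prelimitRecOn with
  | succ i _ ih =>
    intro a ha
    have comp : ∀ (k j : Ordinal.{u}) (hkj : k ≤ j) (hji : j ≤ succ i),
        rawConn j k hkj (rawConn (succ i) j hji a) = rawConn (succ i) k (hkj.trans hji) a := by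
      intro k j hkj hji
      induction j using SuccOrder.prelimitRecOn with
      | succ j _ ihj =>
        clear ihj
        induction k using SuccOrder.prelimitRecOn with
        | succ k _ _ =>
          rw [rawConn_succ_succ, rawConn_succ_succ, rawConn_succ_succ, Equiv.apply_symm_apply,
            Set.image_image]
          congr 1
          refine Set.image_congr fun b hb => ?_
          exact (ih b ((isElement_succ.1 ha).2 b hb)).1 _ _ _ _
        | isSuccPrelimit k hk ihk =>
          rw [rawConn_succ_limit hk, rawConn_succ_limit hk]
          congr 1
          funext l hl
          exact ihk l hl (hl.le.trans hkj)
      | isSuccPrelimit j hj _ =>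
        rcases hkj.lt_or_eq with hlt | rfl
        · rw [rawConn_limit hj hlt, rawConn_succ_limit hj, Equiv.apply_symm_apply]
        · exact rawConn_self _ _
    refine ⟨comp, fun j hji => ?_⟩
    induction j using SuccOrder.prelimitRecOn with
    | succ j _ _ =>
      rw [rawConn_succ_succ, isElement_succ, Equiv.apply_symm_apply]
      refine ⟨(isElement_succ.1 ha).1.image _, ?_⟩
      rintro _ ⟨b, hb, rfl⟩
      exact (ih b ((isElement_succ.1 ha).2 b hb)).2 _ _
    | isSuccPrelimit j hj ihj =>
      rw [rawConn_succ_limit hj, isElement_limit hj, Equiv.apply_symm_apply]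
      exact ⟨fun k hk => ihj k hk _, fun l k hlk hk => comp _ _ _ _⟩
  | isSuccPrelimit i hi ih =>
    intro a ha
    have ha' := (isElement_limit hi).1 ha
    constructor
    · intro k j hkj hji
      rcases hji.lt_or_eq with hlt | rfl
      · rw [rawConn_limit hi hlt, rawConn_limit hi (hkj.trans_lt hlt), ha'.2]
      · rw [rawConn_self]
    · intro j hji
      rcases hji.lt_or_eq with hlt | rfl
      · rw [rawConn_limit hi hlt]
        exact ha'.1 j hlt
      · rwa [rawConn_self]

/-- The final chain of `𝒫_{<κ}`, an inverse chain indexed by the ordinals. For `κ = ⊤` this is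
the final chain of the powerset functor. -/
noncomputable def finalChain (κ : WithTop Cardinal.{u}) :
    InverseChain.{u + 1, u + 1} Ordinal.{u} where
  level i := {a : Raw i // IsElement κ i a}
  map {j i} h a := ⟨rawConn i j h a.1, (isElement_rawConn_and i a.1 a.2).2 j h⟩
  map_id i x := Subtype.ext (rawConn_self i x.1)
  map_comp {k j i} hkj hji x := Subtype.ext ((isElement_rawConn_and i x.1 x.2).1 k j hkj hji)

/-! ## Coalgebra projections -/

/-- The projections `pᵢ` from a transition system: `pᵢ₊₁ x = {pᵢ y | x ⇝ y}`, and `pᵢ x` is the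
tuple `(pⱼ x)_{j < i}` if `i` is a limit (or `0`). -/
noncomputable def rawProj {X : Type v} (r : X → X → Prop) (i : Ordinal.{u}) : X → Raw i :=
  SuccOrder.prelimitRecOn (motive := fun i : Ordinal.{u} => X → Raw i) i
    (fun i _ p x => (succEquiv i).symm (p '' {y | r x y}))
    (fun _ hi p x => (limEquiv hi).symm fun j hj => p j hj x)

theorem rawProj_succ {X : Type v} (r : X → X → Prop) (i : Ordinal.{u}) (x : X) :
    rawProj r (succ i) x = (succEquiv i).symm (rawProj r i '' {y | r x y}) := by
  rw [rawProj, SuccOrder.prelimitRecOn_succ]; rfl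

theorem rawProj_limit {X : Type v} (r : X → X → Prop) {i : Ordinal.{u}} (hi : IsSuccPrelimit i)
    (x : X) : rawProj r i x = (limEquiv hi).symm fun j _ => rawProj r j x := by
  rw [rawProj, SuccOrder.prelimitRecOn_of_isSuccPrelimit _ _ hi]; rfl

theorem rawConn_rawProj {X : Type v} (r : X → X → Prop) (i : Ordinal.{u}) :
    ∀ (j : Ordinal.{u}) (h : j ≤ i) (x : X), rawConn i j h (rawProj r i x) = rawProj r j x := by
  induction i using SuccOrder.prelimitRecOn with
  | succ i _ ih =>
    intro j h x
    induction j using SuccOrder.prelimitRecOn with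
    | succ j _ _ =>
      rw [rawConn_succ_succ, rawProj_succ, rawProj_succ, Equiv.apply_symm_apply, Set.image_image]
      congr 1
      exact Set.image_congr fun b _ => ih _ _ _
    | isSuccPrelimit j hj ihj =>
      rw [rawConn_succ_limit hj, rawProj_limit r hj]
      congr 1
      funext k hk
      exact ihj k hk _
  | isSuccPrelimit i hi _ =>
    intro j h x
    rcases h.lt_or_eq with hlt | rfl
    · rw [rawConn_limit hi hlt, rawProj_limit r hi, Equiv.apply_symm_apply]
    · exact rawConn_self _ _

theorem isElement_rawProj {κ : WithTop Cardinal.{u}} {X : Type v} (r : X → X → Prop)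
    (i : Ordinal.{u}) : ∀ x : X,
      (∀ y, Relation.ReflTransGen r x y → SizeLT κ {z | r y z}) →
      IsElement κ i (rawProj r i x) := by
  induction i using SuccOrder.prelimitRecOn with
  | succ i _ ih =>
    intro x hx
    rw [rawProj_succ, isElement_succ, Equiv.apply_symm_apply]
    refine ⟨(hx x .refl).image _, ?_⟩
    rintro _ ⟨y, hy, rfl⟩
    exact ih y fun z hz => hx z (.head hy hz)
  | isSuccPrelimit i hi ih =>
    intro x hx
    rw [rawProj_limit r hi, isElement_limit hi, Equiv.apply_symm_apply]
    exact ⟨fun j hj => ih j hj x hx, fun k j hkj _ => rawConn_rawProj r j k hkj x⟩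

/-- The projection `pᵢ(x)` of a `<κ`-branching pointed system `x`, as an element of the `i`-th
level of the final chain of `𝒫_{<κ}`. -/
noncomputable def PointedSystem.proj {κ : WithTop Cardinal.{u}} (i : Ordinal.{u})
    (x : PointedSystem.{v}) (hx : x.Branching κ) : (finalChain κ).level i :=
  ⟨rawProj x.step i x.pt, isElement_rawProj x.step i x.pt hx⟩

/-! ## The final chain as a transition system -/

/-- The transition relation on the final chain of the powerset functor. An element `a` at level
`i + 1` has its members as successors, at level `i`. If `i` is a limit (or `0`), then an element
`a` at level `i` has as successors those `b` at level `i` with `b_j ∈ a_{j+1}` for all `j < i`. -/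
inductive ChainStep :
    (Σ i : Ordinal.{u}, (finalChain.{u} ⊤).level i) →
      (Σ i : Ordinal.{u}, (finalChain.{u} ⊤).level i) → Prop
  | succ (i : Ordinal.{u}) (a : (finalChain.{u} ⊤).level (succ i))
      (b : (finalChain.{u} ⊤).level i) (h : b.1 ∈ succEquiv i a.1) : ChainStep ⟨succ i, a⟩ ⟨i, b⟩
  | limit (i : Ordinal.{u}) (hi : IsSuccPrelimit i) (a b : (finalChain.{u} ⊤).level i)
      (h : ∀ (j : Ordinal.{u}) (hj : j < i),
        limEquiv hi b.1 j hj ∈ succEquiv j (limEquiv hi a.1 (succ j) (hi.succ_lt hj))) :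
      ChainStep ⟨i, a⟩ ⟨i, b⟩

/-- An element of the final chain of `𝒫_{<κ}`, regarded as a pointed system: the final chain of
`𝒫_{<κ}` is contained in that of the powerset functor. -/
noncomputable def toSystem {κ : WithTop Cardinal.{u}} {i : Ordinal.{u}}
    (a : (finalChain κ).level i) : PointedSystem.{u + 1} where
  carrier := Σ i : Ordinal.{u}, (finalChain.{u} ⊤).level i
  step := ChainStep
  pt := ⟨i, a.1, IsElement.top a.2⟩

end GhostChain

namespace GhostChain

/-! ## Approximants and projections -/

/-! Two points are `∼ᵢ`-related exactly when their `i`-th projections coincide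
(`rawProj_eq_iff_approx`). So `b ∼ⱼ a` says that `b` and `a`, read as pointed systems, have the same
projection to level `j`, and everything turns on when the projection `chainProj j a` of an element
is its component `rawConn i j _ a`.

Positive direction (`chainProj_eq_rawConn`): the only obstacle is a limit level, where the
successors of `a` are the full branches through the sets `a_{k+1}`, and one needs every `e ∈
a_{k+1}` to lie on such a branch. These sets form an inverse system with surjective maps. Branches
are found by dependent choice if the limit is `ω`-cofinal, by the tree property if the levels are
small, and beyond `κ` because the connecting maps down to level `κ` are injective
(`Extensible.exists_branch`).

Negative direction: at a limit `j` that is not extensible there is a ghost (`exists_ghost`), an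
element all of whose sets `a_{k+1}` are nonempty but which has no successor. It comes from a tree of
height `j` without full branches. The nodes are coded by hereditary sets of ordinals, in such a way
that depth `k + 2` sees the code of a node only through its restriction to height `k`, while a
coherent family of codes determines a full branch. The trees are counterexamples to the tree
property, or a tree of finite subsets of a cofinal set when `j` has cofinality at most `2 ^ μ` for
some `μ < j`.

A ghost behaves like a deadlock without being the projection of one. Its `m`-fold singleton behaves
like the chain of `m` transitions and differs from that chain's projection at every level above `m`
(`exists_fake_nat`). Comparing this fake with the genuine chain refutes uniqueness in all remaining
cases. -/

theorem rawProj_eq_iff_approx {X : Type v} {Y : Type w} (r : X → X → Prop) (s : Y → Y → Prop)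
    (i : Ordinal.{u}) : ∀ (x : X) (y : Y), rawProj r i x = rawProj s i y ↔ Approx r s i x y := by
  induction i using SuccOrder.prelimitRecOn with
  | succ i _ ih =>
    intro x y
    rw [rawProj_succ, rawProj_succ, approx_succ, Equiv.apply_eq_iff_eq]
    simp only [← ih]
    constructor
    · intro h
      constructor
      · intro a ha
        obtain ⟨b, hb, e⟩ := h ▸ Set.mem_image_of_mem (rawProj r i) (show a ∈ {y | r x y} from ha)
        exact ⟨b, hb, e.symm⟩
      · intro b hb
        obtain ⟨a, ha, e⟩ :=
          h.symm ▸ Set.mem_image_of_mem (rawProj s i) (show b ∈ {z | s y z} from hb)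
        exact ⟨a, ha, e⟩
    · rintro ⟨h1, h2⟩
      ext c
      constructor
      · rintro ⟨a, ha, rfl⟩
        obtain ⟨b, hb, e⟩ := h1 a ha
        exact ⟨b, hb, e.symm⟩
      · rintro ⟨b, hb, rfl⟩
        obtain ⟨a, ha, e⟩ := h2 b hb
        exact ⟨a, ha, e⟩
  | isSuccPrelimit i hi ih =>
    intro x y
    rw [rawProj_limit r hi, rawProj_limit s hi, approx_limit _ _ hi, Equiv.apply_eq_iff_eq]
    constructor
    · intro h j hj
      exact (ih j hj x y).1 (congrFun (congrFun h j) hj)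
    · intro h
      funext j hj
      exact (ih j hj x y).2 (h j hj)

theorem Approx.mono {X : Type v} {Y : Type w} {r : X → X → Prop} {s : Y → Y → Prop}
    {i j : Ordinal.{u}} (hji : j ≤ i) {x : X} {y : Y} (h : Approx r s i x y) :
    Approx r s j x y := by
  rw [← rawProj_eq_iff_approx] at h ⊢
  rw [← rawConn_rawProj r i j hji, ← rawConn_rawProj s i j hji, h]

theorem Approx.refl {X : Type v} (r : X → X → Prop) (i : Ordinal.{u}) (x : X) :
    Approx r r i x x := (rawProj_eq_iff_approx r r i x x).1 rfl

/-! ## Elements of the final chain -/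

theorem limEquiv_eq_rawConn {i j : Ordinal.{u}} (hi : IsSuccPrelimit i) (hj : j < i) (a : Raw i) :
    limEquiv hi a j hj = rawConn i j hj.le a := (rawConn_limit hi hj a).symm

theorem IsElement.rawConn {κ : WithTop Cardinal.{u}} {i j : Ordinal.{u}} {a : Raw i}
    (ha : IsElement κ i a) (h : j ≤ i) : IsElement κ j (rawConn i j h a) :=
  (isElement_rawConn_and i a ha).2 j h

theorem IsElement.rawConn_rawConn {κ : WithTop Cardinal.{u}} {i j k : Ordinal.{u}} {a : Raw i}
    (ha : IsElement κ i a) (hkj : k ≤ j) (hji : j ≤ i) :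
    GhostChain.rawConn j k hkj (GhostChain.rawConn i j hji a) =
      GhostChain.rawConn i k (hkj.trans hji) a :=
  (isElement_rawConn_and i a ha).1 k j hkj hji

/-- The set of level-`k` components of the candidate successors of `a`. -/
noncomputable def members {i : Ordinal.{u}} (a : Raw i) (k : Ordinal.{u}) (hk : succ k ≤ i) :
    Set (Raw k) :=
  succEquiv k (rawConn i (succ k) hk a)

/-- This is coherence of `a` between levels `l + 1` and `k + 1`. It makes the sets `members a k` an
inverse system with surjective maps, so that the successors of `a` at a limit level are its full
branches. -/
theorem members_image {κ : WithTop Cardinal.{u}} {i : Ordinal.{u}} {a : Raw i}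
    (ha : IsElement κ i a) {k l : Ordinal.{u}} (hkl : k ≤ l) (hl : succ l ≤ i) :
    rawConn l k hkl '' members a l hl = members a k ((succ_le_succ hkl).trans hl) := by
  have h := ha.rawConn_rawConn (succ_le_succ hkl) hl
  rw [rawConn_succ_succ, Equiv.symm_apply_eq] at h
  exact h

theorem isElement_of_mem_members {κ : WithTop Cardinal.{u}} {i : Ordinal.{u}} {a : Raw i}
    (ha : IsElement κ i a) {k : Ordinal.{u}} (hk : succ k ≤ i) {b : Raw k}
    (hb : b ∈ members a k hk) : IsElement κ k b :=
  (isElement_succ.1 (ha.rawConn hk)).2 b hb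

theorem sizeLT_members {κ : WithTop Cardinal.{u}} {i : Ordinal.{u}} {a : Raw i}
    (ha : IsElement κ i a) {k : Ordinal.{u}} (hk : succ k ≤ i) : SizeLT κ (members a k hk) :=
  (isElement_succ.1 (ha.rawConn hk)).1

theorem members_succ_self {i : Ordinal.{u}} (a : Raw (succ i)) :
    members a i le_rfl = succEquiv i a := by
  rw [members, rawConn_self]

theorem rawConn_succ_eq_members {i : Ordinal.{u}} (a : Raw i) (k : Ordinal.{u}) (hk : succ k ≤ i) :
    rawConn i (succ k) hk a = (succEquiv k).symm (members a k hk) := by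
  rw [members, Equiv.symm_apply_apply]

theorem raw_ext_of_rawConn {i : Ordinal.{u}} (hi : IsSuccPrelimit i) {a b : Raw i}
    (h : ∀ j (hj : j < i), rawConn i j hj.le a = rawConn i j hj.le b) : a = b := by
  apply (limEquiv hi).injective
  funext j hj
  rw [limEquiv_eq_rawConn, limEquiv_eq_rawConn]
  exact h j hj

/-- A compatible family below a limit is an element. -/
theorem exists_isElement_of_compatible {κ : WithTop Cardinal.{u}} {i : Ordinal.{u}}
    (hi : IsSuccPrelimit i) (b : ∀ k : Ordinal.{u}, k < i → Raw k)
    (hb : ∀ k hk, IsElement κ k (b k hk))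
    (hc : ∀ k l (hkl : k ≤ l) (hl : l < i), rawConn l k hkl (b l hl) = b k (hkl.trans_lt hl)) :
    ∃ c : Raw i, IsElement κ i c ∧ ∀ k (hk : k < i), rawConn i k hk.le c = b k hk := by
  refine ⟨(limEquiv hi).symm b, ?_, fun k hk => ?_⟩
  · rw [isElement_limit hi, Equiv.apply_symm_apply]
    exact ⟨hb, hc⟩
  · rw [rawConn_limit hi hk, Equiv.apply_symm_apply]

/-! ## Transitions in the final chain -/

theorem chainStep_succ_iff {i : Ordinal.{u}} {a : (finalChain.{u} ⊤).level (succ i)}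
    {y : Σ i : Ordinal.{u}, (finalChain.{u} ⊤).level i} :
    ChainStep ⟨succ i, a⟩ y ↔ ∃ b : (finalChain.{u} ⊤).level i,
      y = ⟨i, b⟩ ∧ b.1 ∈ members a.1 i le_rfl := by
  rw [members_succ_self]
  constructor
  · intro h
    generalize hx : (⟨succ i, a⟩ : Σ i : Ordinal.{u}, (finalChain.{u} ⊤).level i) = x at h
    cases h with
    | succ j a' b hb =>
      have e : i = j := succ_injective (congrArg Sigma.fst hx)
      subst e
      obtain rfl : a = a' := by simpa using hx
      exact ⟨b, rfl, hb⟩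
    | limit j hj a' b hb =>
      have e : succ i = j := congrArg Sigma.fst hx
      exact absurd (e ▸ hj) (not_isSuccPrelimit_succ i)
  · rintro ⟨b, rfl, hb⟩
    exact ChainStep.succ i a b hb

theorem chainStep_limit_iff {i : Ordinal.{u}} (hi : IsSuccPrelimit i)
    {a : (finalChain.{u} ⊤).level i} {y : Σ i : Ordinal.{u}, (finalChain.{u} ⊤).level i} :
    ChainStep ⟨i, a⟩ y ↔ ∃ b : (finalChain.{u} ⊤).level i,
      y = ⟨i, b⟩ ∧ ∀ k (hk : k < i),
        rawConn i k hk.le b.1 ∈ members a.1 k (succ_le_of_lt hk) := by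
  constructor
  · intro h
    generalize hx : (⟨i, a⟩ : Σ i : Ordinal.{u}, (finalChain.{u} ⊤).level i) = x at h
    cases h with
    | succ j a' b hb =>
      have e : i = succ j := congrArg Sigma.fst hx
      exact absurd (e ▸ hi) (not_isSuccPrelimit_succ j)
    | limit j hj a' b hb =>
      have e : i = j := congrArg Sigma.fst hx
      subst e
      obtain rfl : a = a' := by simpa using hx
      refine ⟨b, rfl, fun k hk => ?_⟩
      have := hb k hk
      rwa [limEquiv_eq_rawConn, limEquiv_eq_rawConn] at this
  · rintro ⟨b, rfl, hb⟩
    refine ChainStep.limit i hi a b fun k hk => ?_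
    have := hb k hk
    rwa [limEquiv_eq_rawConn, limEquiv_eq_rawConn]

/-! ## Limit and finite parts -/

theorem isSuccPrelimit_limitPart (i : Ordinal.{u}) : IsSuccPrelimit (limitPart i) :=
  Ordinal.isSuccPrelimit_iff_omega0_dvd.2 ⟨_, rfl⟩

theorem exists_finitePart_eq (i : Ordinal.{u}) : ∃ m : ℕ, finitePart i = m :=
  Ordinal.lt_omega0.1 (Ordinal.mod_lt i Ordinal.omega0_ne_zero)

theorem eq_limitPart_add {i : Ordinal.{u}} {m : ℕ} (h : finitePart i = m) :
    i = limitPart i + m :=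
  ((eq_add_natCast_iff i (limitPart i) m).2 ⟨rfl, h⟩).2

theorem limitPart_succ (i : Ordinal.{u}) : limitPart (succ i) = limitPart i := by
  obtain ⟨m, hm⟩ := exists_finitePart_eq i
  refine ((eq_add_natCast_iff (succ i) (limitPart i) (m + 1)).1
    ⟨isSuccPrelimit_limitPart i, ?_⟩).1
  conv_lhs => rw [eq_limitPart_add hm]
  rw [Order.succ_eq_add_one, Nat.cast_succ, add_assoc]

theorem finitePart_succ (i : Ordinal.{u}) : finitePart (succ i) = succ (finitePart i) := by
  obtain ⟨m, hm⟩ := exists_finitePart_eq i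
  rw [hm, ((eq_add_natCast_iff (succ i) (limitPart i) (m + 1)).1
    ⟨isSuccPrelimit_limitPart i, ?_⟩).2, Nat.cast_succ, Order.succ_eq_add_one]
  conv_lhs => rw [eq_limitPart_add hm]
  rw [Order.succ_eq_add_one, Nat.cast_succ, add_assoc]

theorem limitPart_of_isSuccPrelimit {i : Ordinal.{u}} (hi : IsSuccPrelimit i) :
    limitPart i = i :=
  ((eq_add_natCast_iff i i 0).1 ⟨hi, by simp⟩).1

theorem finitePart_of_isSuccPrelimit {i : Ordinal.{u}} (hi : IsSuccPrelimit i) :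
    finitePart i = 0 := by
  simpa using ((eq_add_natCast_iff i i 0).1 ⟨hi, by simp⟩).2

theorem limitPart_eq_zero_of_lt_omega0 {i : Ordinal.{u}} (hi : i < Ordinal.omega0) :
    limitPart i = 0 := by
  rw [limitPart, Ordinal.div_eq_zero_of_lt hi, mul_zero]

/-! ## Sizes -/

theorem SizeLT.mono {κ : WithTop Cardinal.{u}} {X : Type v} {s t : Set X} (h : s ⊆ t)
    (ht : SizeLT κ t) : SizeLT κ s := fun c hc =>
  (Cardinal.lift_le.2 (Cardinal.mk_le_mk_of_subset h)).trans_lt (ht c hc)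

theorem SizeLT.union {κ : WithTop Cardinal.{u}}
    (hκ : ∀ c : Cardinal.{u}, κ = (c : WithTop Cardinal.{u}) → c.IsRegular)
    {X : Type v} {s t : Set X} (hs : SizeLT κ s) (ht : SizeLT κ t) : SizeLT κ (s ∪ t) :=
  fun c hc => by
    refine (Cardinal.lift_le.2 (Cardinal.mk_union_le s t)).trans_lt ?_
    rw [Cardinal.lift_add]
    refine Cardinal.add_lt_of_lt ?_ (hs c hc) (ht c hc)
    simpa using (hκ c hc).aleph0_le

theorem SizeLT.of_subsingleton {κ : WithTop Cardinal.{u}}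
    (hκ : ∀ c : Cardinal.{u}, κ = (c : WithTop Cardinal.{u}) → c.IsRegular)
    {X : Type v} {s : Set X} (hs : s.Subsingleton) : SizeLT κ s := fun c hc => by
  refine lt_of_le_of_lt (b := (1 : Cardinal)) ?_ ?_
  · rw [Cardinal.lift_le_one_iff]
    exact Cardinal.mk_le_one_iff_set_subsingleton.2 hs
  · rw [Cardinal.one_lt_lift_iff]
    exact Cardinal.one_lt_aleph0.trans_le (hκ c hc).aleph0_le

theorem SizeLT.Iio {κ : WithTop Cardinal.{u}} {j : Ordinal.{u}}
    (hj : ∀ c : Cardinal.{u}, κ = (c : WithTop Cardinal.{u}) → j < c.ord) :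
    SizeLT κ (Set.Iio j) := fun c hc => by
  rw [Cardinal.mk_Iio_ordinal, Cardinal.lift_lift, Cardinal.lift_lt]
  exact Cardinal.lt_ord.1 (hj c hc)

/-! ## A transition system of iterated sets of ordinals -/

/-- Ordinals, sets of ordinals, sets of sets of ordinals and so on, up to three iterations. -/
inductive Node : Type (u + 1)
  | ord (a : Ordinal.{u})
  | one (s : Set Ordinal.{u})
  | two (s : Set (Set Ordinal.{u}))
  | three (s : Set (Set (Set Ordinal.{u})))

/-- The membership relation on `Node`, an ordinal being the set of smaller ordinals. -/
def Node.Step : Node.{u} → Node.{u} → Prop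
  | .ord a, .ord b => b < a
  | .one s, .ord a => a ∈ s
  | .two s, .one a => a ∈ s
  | .three s, .two a => a ∈ s
  | _, _ => False

namespace Node

/-- Approximate equality of nodes. -/
def Sim (i : Ordinal.{u}) (x y : Node.{u}) : Prop := Approx Step Step i x y

theorem sim_one_iff {i : Ordinal.{u}} {s t : Set Ordinal.{u}} :
    Sim (succ i) (one s) (one t) ↔
      (∀ a ∈ s, ∃ b ∈ t, Sim i (ord a) (ord b)) ∧ (∀ b ∈ t, ∃ a ∈ s, Sim i (ord a) (ord b)) := by
  rw [Sim, approx_succ]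
  constructor
  · rintro ⟨h1, h2⟩
    constructor
    · intro a ha
      obtain ⟨_ | _ | _ | _, hy, e⟩ := h1 (ord a) ha
      · exact ⟨_, hy, e⟩
      all_goals exact hy.elim
    · intro a ha
      obtain ⟨_ | _ | _ | _, hy, e⟩ := h2 (ord a) ha
      · exact ⟨_, hy, e⟩
      all_goals exact hy.elim
  · rintro ⟨h1, h2⟩
    constructor
    · rintro (a | _ | _ | _) hy
      · obtain ⟨b, hb, e⟩ := h1 a hy
        exact ⟨ord b, hb, e⟩
      all_goals exact hy.elim
    · rintro (a | _ | _ | _) hy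
      · obtain ⟨b, hb, e⟩ := h2 a hy
        exact ⟨ord b, hb, e⟩
      all_goals exact hy.elim

theorem sim_two_iff {i : Ordinal.{u}} {s t : Set (Set Ordinal.{u})} :
    Sim (succ i) (two s) (two t) ↔
      (∀ a ∈ s, ∃ b ∈ t, Sim i (one a) (one b)) ∧ (∀ b ∈ t, ∃ a ∈ s, Sim i (one a) (one b)) := by
  rw [Sim, approx_succ]
  constructor
  · rintro ⟨h1, h2⟩
    constructor
    · intro a ha
      obtain ⟨_ | _ | _ | _, hy, e⟩ := h1 (one a) ha
      · exact hy.elim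
      · exact ⟨_, hy, e⟩
      all_goals exact hy.elim
    · intro a ha
      obtain ⟨_ | _ | _ | _, hy, e⟩ := h2 (one a) ha
      · exact hy.elim
      · exact ⟨_, hy, e⟩
      all_goals exact hy.elim
  · rintro ⟨h1, h2⟩
    constructor
    · rintro (_ | a | _ | _) hy
      · exact hy.elim
      · obtain ⟨b, hb, e⟩ := h1 a hy
        exact ⟨one b, hb, e⟩
      all_goals exact hy.elim
    · rintro (_ | a | _ | _) hy
      · exact hy.elim
      · obtain ⟨b, hb, e⟩ := h2 a hy
        exact ⟨one b, hb, e⟩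
      all_goals exact hy.elim

theorem sim_three_of {i : Ordinal.{u}} {s t : Set (Set (Set Ordinal.{u}))}
    (h1 : ∀ a ∈ s, ∃ b ∈ t, Sim i (two a) (two b)) (h2 : ∀ b ∈ t, ∃ a ∈ s, Sim i (two a) (two b)) :
    Sim (succ i) (three s) (three t) := by
  rw [Sim, approx_succ]
  constructor
  · rintro (_ | _ | a | _) hy
    · exact hy.elim
    · exact hy.elim
    · obtain ⟨b, hb, e⟩ := h1 a hy
      exact ⟨two b, hb, e⟩
    · exact hy.elim
  · rintro (_ | _ | a | _) hy
    · exact hy.elim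
    · exact hy.elim
    · obtain ⟨b, hb, e⟩ := h2 a hy
      exact ⟨two b, hb, e⟩
    · exact hy.elim

/-- Depth `i` sees an ordinal exactly below `i` and identifies all those from `i` on. This
truncation is what lets labels placed high up stay invisible from below. -/
theorem sim_ord_iff (i : Ordinal.{u}) : ∀ a b : Ordinal.{u},
    Sim i (ord a) (ord b) ↔ a = b ∨ (i ≤ a ∧ i ≤ b) := by
  induction i using SuccOrder.prelimitRecOn with
  | succ i _ ih =>
    have key : ∀ a b : Ordinal.{u}, Sim (succ i) (ord a) (ord b) ↔
        (∀ a' < a, ∃ b' < b, a' = b' ∨ (i ≤ a' ∧ i ≤ b')) ∧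
          (∀ b' < b, ∃ a' < a, a' = b' ∨ (i ≤ a' ∧ i ≤ b')) := by
      intro a b
      simp only [← ih]
      rw [Sim, approx_succ]
      constructor
      · rintro ⟨h1, h2⟩
        constructor
        · intro a ha
          obtain ⟨_ | _ | _ | _, hy, e⟩ := h1 (ord a) ha
          · exact ⟨_, hy, e⟩
          all_goals exact hy.elim
        · intro a ha
          obtain ⟨_ | _ | _ | _, hy, e⟩ := h2 (ord a) ha
          · exact ⟨_, hy, e⟩
          all_goals exact hy.elim
      · rintro ⟨h1, h2⟩
        constructor
        · rintro (a | _ | _ | _) hy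
          · obtain ⟨b, hb, e⟩ := h1 a hy
            exact ⟨ord b, hb, e⟩
          all_goals exact hy.elim
        · rintro (a | _ | _ | _) hy
          · obtain ⟨b, hb, e⟩ := h2 a hy
            exact ⟨ord b, hb, e⟩
          all_goals exact hy.elim
    intro a b
    rw [key, succ_le_iff, succ_le_iff]
    constructor
    · rintro ⟨h1, h2⟩
      rcases lt_trichotomy a b with hab | hab | hab
      · obtain ⟨a', ha', h | ⟨h, -⟩⟩ := h2 a hab
        · exact absurd h ha'.ne
        · exact Or.inr ⟨h.trans_lt ha', (h.trans_lt ha').trans hab⟩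
      · exact Or.inl hab
      · obtain ⟨b', hb', h | ⟨-, h⟩⟩ := h1 b hab
        · exact absurd h.symm hb'.ne
        · exact Or.inr ⟨(h.trans_lt hb').trans hab, h.trans_lt hb'⟩
    · rintro (rfl | ⟨ha, hb⟩)
      · exact ⟨fun a' h => ⟨a', h, Or.inl rfl⟩, fun a' h => ⟨a', h, Or.inl rfl⟩⟩
      · constructor
        · intro a' _
          rcases lt_or_ge a' i with h | h
          · exact ⟨a', h.trans hb, Or.inl rfl⟩
          · exact ⟨i, hb, Or.inr ⟨h, le_rfl⟩⟩
        · intro b' _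
          rcases lt_or_ge b' i with h | h
          · exact ⟨b', h.trans ha, Or.inl rfl⟩
          · exact ⟨i, ha, Or.inr ⟨le_rfl, h⟩⟩
  | isSuccPrelimit i hi ih =>
    intro a b
    rw [Sim, approx_limit _ _ hi]
    constructor
    · intro h
      by_cases hab : a = b
      · exact Or.inl hab
      have h' : ∀ k < i, k ≤ a ∧ k ≤ b := fun k hk =>
        ((ih k hk a b).1 (h k hk)).resolve_left hab
      refine Or.inr ⟨not_lt.1 fun hlt => ?_, not_lt.1 fun hlt => ?_⟩
      · exact (lt_succ a).not_ge (h' _ (hi.succ_lt hlt)).1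
      · exact (lt_succ b).not_ge (h' _ (hi.succ_lt hlt)).2
    · intro h k hk
      exact (ih k hk a b).2 (h.imp_right fun h => ⟨hk.le.trans h.1, hk.le.trans h.2⟩)

/-- At depth `k` the ordinal `i` and all elements of `s` from `i` on look like `k`. What remains
visible is the bottom part `c`, which lies below `μ ≤ k`. -/
theorem sim_one_insert {k i μ : Ordinal.{u}} (hki : k ≤ i) (hμ : μ ≤ k) {s c : Set Ordinal.{u}}
    (hc : c ⊆ Set.Iio μ) (hs : s ∩ Set.Iio i = c) :
    Sim (succ k) (one (insert i s)) (one (insert k c)) := by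
  rw [sim_one_iff]
  simp only [sim_ord_iff]
  subst hs
  constructor
  · rintro a (rfl | ha)
    · exact ⟨k, Or.inl rfl, Or.inr ⟨hki, le_rfl⟩⟩
    · rcases lt_or_ge a i with h | h
      · exact ⟨a, Or.inr ⟨ha, h⟩, Or.inl rfl⟩
      · exact ⟨k, Or.inl rfl, Or.inr ⟨hki.trans h, le_rfl⟩⟩
  · rintro b (rfl | hb)
    · exact ⟨i, Or.inl rfl, Or.inr ⟨hki, le_rfl⟩⟩
    · exact ⟨b, Or.inr hb.1, Or.inl rfl⟩

theorem mem_iff_of_sim {g : Ordinal.{u}} {s t : Set Ordinal.{u}}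
    (h : Sim (succ g) (one s) (one t)) {x : Ordinal.{u}} (hx : x < g) : x ∈ s ↔ x ∈ t := by
  rw [sim_one_iff] at h
  simp only [sim_ord_iff] at h
  constructor
  · intro hs
    obtain ⟨y, hy, rfl | ⟨h, -⟩⟩ := h.1 x hs
    · exact hy
    · exact absurd hx h.not_gt
  · intro ht
    obtain ⟨y, hy, rfl | ⟨-, h⟩⟩ := h.2 x ht
    · exact hy
    · exact absurd hx h.not_gt

/-- Nodes built from ordinals below `j` and `<κ`-sized sets. -/
def Small (κ : WithTop Cardinal.{u}) (j : Ordinal.{u}) : Node.{u} → Prop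
  | ord a => a < j
  | one s => SizeLT κ s ∧ s ⊆ Set.Iio j
  | two s => SizeLT κ s ∧ ∀ a ∈ s, SizeLT κ a ∧ a ⊆ Set.Iio j
  | three s => SizeLT κ s ∧ ∀ b ∈ s, SizeLT κ b ∧ ∀ a ∈ b, SizeLT κ a ∧ a ⊆ Set.Iio j

theorem Small.step {κ : WithTop Cardinal.{u}} {j : Ordinal.{u}} {x y : Node.{u}}
    (hx : Small κ j x) (h : Step x y) : Small κ j y := by
  rcases x with _ | _ | _ | _ <;> rcases y with _ | _ | _ | _ <;> try exact h.elim
  · exact lt_trans h hx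
  · exact hx.2 h
  · exact hx.2 _ h
  · exact hx.2 _ h

/-- The hypothesis on `j` amounts to `j ≤ κ`. It is needed because an ordinal node has all smaller
ordinals as successors. -/
theorem Small.sizeLT {κ : WithTop Cardinal.{u}} {j : Ordinal.{u}}
    (hj : ∀ i < j, SizeLT κ (Set.Iio i)) {x : Node.{u}} (hx : Small κ j x) :
    SizeLT κ {y | Step x y} := by
  rcases x with a | s | s | s
  · refine ((hj a hx).image ord).mono ?_
    rintro (b | _ | _ | _) h
    · exact ⟨b, h, rfl⟩
    all_goals exact h.elim
  · refine (hx.1.image ord).mono ?_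
    rintro (b | _ | _ | _) h
    · exact ⟨b, h, rfl⟩
    all_goals exact h.elim
  · refine (hx.1.image one).mono ?_
    rintro (_ | b | _ | _) h
    · exact h.elim
    · exact ⟨b, h, rfl⟩
    all_goals exact h.elim
  · refine (hx.1.image two).mono ?_
    rintro (_ | _ | b | _) h
    · exact h.elim
    · exact h.elim
    · exact ⟨b, h, rfl⟩
    · exact h.elim

theorem Small.isElement {κ : WithTop Cardinal.{u}} {j : Ordinal.{u}}
    (hj : ∀ i < j, SizeLT κ (Set.Iio i)) {x : Node.{u}} (hx : Small κ j x) (i : Ordinal.{u}) :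
    IsElement κ i (rawProj Step i x) := by
  refine isElement_rawProj _ _ _ fun y hy => Small.sizeLT hj ?_
  induction hy with
  | refl => exact hx
  | tail _ h ih => exact ih.step h

end Node

/-! ## Ghosts from trees without full branches -/

/-- A tree of height `j` without full branches, together with a labelling of its nodes by sets of
ordinals which is invisible from below the height of the node. -/
structure LabelledTree (κ : WithTop Cardinal.{u}) (j : Ordinal.{u}) where
  tree : InverseChain.{u + 1, w} (Set.Iio j)
  surj : ∀ (k l : Set.Iio j) (h : k ≤ l), Function.Surjective (tree.map h)
  nonempty : ∀ k, Nonempty (tree.level k)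
  noBranch : ¬ tree.HasFullBranch
  sizeLT : ∀ k, SizeLT κ (Set.univ : Set (tree.level k))
  base : Set.Iio j
  bottoms : Set (Set Ordinal.{u})
  bottoms_lt : ∀ c ∈ bottoms, c ⊆ Set.Iio (base : Ordinal.{u})
  bottoms_sizeLT : SizeLT κ bottoms
  bound : Set.Iio j → Set.Iio j
  lt_bound : ∀ k, k < bound k
  label : ∀ k, tree.level k → Set Ordinal.{u}
  label_injective : ∀ k, Function.Injective (label k)
  label_inter : ∀ k, base ≤ k → ∀ d, label k d ∩ Set.Iio (k : Ordinal.{u}) ∈ bottoms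
  notMem_label : ∀ k, base ≤ k → ∀ d, (k : Ordinal.{u}) ∉ label k d
  label_lt : ∀ k, base ≤ k → ∀ d, label k d ⊆ Set.Iio (bound k : Ordinal.{u})

namespace LabelledTree

open Node

variable {κ : WithTop Cardinal.{u}} {j : Ordinal.{u}} (L : LabelledTree.{u, w} κ j)

/-- The code of a node of the tree: the labels of the nodes below it, and all possible bottom parts
of labels at its own height. -/
def code (l : Set.Iio j) (d : L.tree.level l) : Set (Set Ordinal.{u}) :=
  {s | ∃ (i : Set.Iio j) (h : i < l), L.base ≤ i ∧
      s = insert (i : Ordinal.{u}) (L.label i (L.tree.map h.le d))} ∪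
    (fun c => insert (l : Ordinal.{u}) c) '' L.bottoms

/-- Entries with index below `k` are common to both codes. An entry with index at least `k` shrinks,
at this depth, to `k` together with the bottom part of its label. Since a code contains every
possible bottom part at its own height, such an entry reveals nothing. -/
theorem sim_code {k l : Set.Iio j} (hk : L.base ≤ k) (hkl : k ≤ l) (d : L.tree.level l) :
    Sim (succ (succ (k : Ordinal.{u}))) (two (L.code l d)) (two (L.code k (L.tree.map hkl d))) := by
  rw [sim_two_iff]
  constructor
  · rintro _ (⟨i, hi, hbi, rfl⟩ | ⟨c, hc, rfl⟩)
    · rcases lt_or_ge i k with hik | hik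
      · refine ⟨_, Or.inl ⟨i, hik, hbi, rfl⟩, ?_⟩
        rw [L.tree.map_comp]
        exact Approx.refl _ _ _
      · exact ⟨_, Or.inr ⟨_, L.label_inter i hbi _, rfl⟩,
          sim_one_insert hik hk (L.bottoms_lt _ (L.label_inter i hbi _)) rfl⟩
    · refine ⟨_, Or.inr ⟨c, hc, rfl⟩, sim_one_insert hkl hk (L.bottoms_lt c hc) ?_⟩
      exact Set.inter_eq_left.2 fun x hx =>
        lt_of_lt_of_le (L.bottoms_lt c hc hx) (show (L.base : Ordinal.{u}) ≤ l from hk.trans hkl)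
  · rintro _ (⟨i, hi, hbi, rfl⟩ | ⟨c, hc, rfl⟩)
    · refine ⟨_, Or.inl ⟨i, hi.trans_le hkl, hbi, rfl⟩, ?_⟩
      rw [L.tree.map_comp]
      exact Approx.refl _ _ _
    · refine ⟨_, Or.inr ⟨c, hc, rfl⟩, sim_one_insert hkl hk (L.bottoms_lt c hc) ?_⟩
      exact Set.inter_eq_left.2 fun x hx =>
        lt_of_lt_of_le (L.bottoms_lt c hc hx) (show (L.base : Ordinal.{u}) ≤ l from hk.trans hkl)

/-- Depth `bound k + 1` sees all of the label at height `k`. The index of an entry can be recovered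
too: below its index, an entry contains only ordinals under `base`, so an entry that looks like the
one with index `k` has index `k`, and injectivity of labels identifies the node. -/
theorem map_eq_of_sim {k : Set.Iio j} (hk : L.base ≤ k) {e : L.tree.level k}
    {d : L.tree.level (L.bound k)} {s : Set Ordinal.{u}} (hs : s ∈ L.code _ d)
    (h : Sim (succ (L.bound k : Ordinal.{u})) (one (insert (k : Ordinal.{u}) (L.label k e)))
      (one s)) :
    L.tree.map (L.lt_bound k).le d = e := by
  have hks : (k : Ordinal.{u}) ∈ s := (mem_iff_of_sim h (L.lt_bound k)).1 (Or.inl rfl)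
  rcases hs with ⟨i, hi, hbi, rfl⟩ | ⟨c, hc, rfl⟩
  · have his := (mem_iff_of_sim h hi).2 (Or.inl rfl)
    rcases lt_trichotomy i k with hik | rfl | hik
    · rcases his with h' | h'
      · exact absurd h' (ne_of_lt hik)
      · exact absurd (L.bottoms_lt _ (L.label_inter k hk e) ⟨h', hik⟩) (not_lt.2 hbi)
    · apply L.label_injective
      ext x
      constructor
      · intro hx
        rcases (mem_iff_of_sim h (L.label_lt _ hk _ hx)).2 (Or.inr hx) with rfl | h'
        · exact absurd hx (L.notMem_label _ hk _)
        · exact h'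
      · intro hx
        rcases (mem_iff_of_sim h (L.label_lt _ hk _ hx)).1 (Or.inr hx) with rfl | h'
        · exact absurd hx (L.notMem_label _ hk _)
        · exact h'
    · rcases hks with h' | h'
      · exact absurd h' (ne_of_lt hik)
      · exact absurd (L.bottoms_lt _ (L.label_inter i hbi _) ⟨h', hik⟩) (not_lt.2 hk)
  · rcases hks with h' | h'
    · exact absurd h' (ne_of_lt (L.lt_bound k))
    · exact absurd (L.bottoms_lt _ hc h') (not_lt.2 hk)

theorem map_eq_map_of_sim {k l : Set.Iio j} (hk : L.base ≤ k) (hl : L.bound k ≤ l)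
    {d : L.tree.level l} {d' : L.tree.level (L.bound k)}
    (h : Sim (succ (succ (L.bound k : Ordinal.{u}))) (two (L.code l d)) (two (L.code _ d'))) :
    L.tree.map (L.lt_bound k).le d' = L.tree.map ((L.lt_bound k).le.trans hl) d := by
  obtain ⟨s, hs, h'⟩ := (sim_two_iff.1 h).1 _
    (Or.inl ⟨k, (L.lt_bound k).trans_le hl, hk, rfl⟩)
  exact L.map_eq_of_sim hk hs h'

/-- If the codes of a family of nodes agree then the tree has a full branch. -/
theorem not_forall_sim (d : ∀ k : Set.Iio j, L.tree.level k)
    (h : ∀ k l : Set.Iio j, L.base ≤ k → k ≤ l →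
      Sim (succ (succ (k : Ordinal.{u}))) (two (L.code l (d l))) (two (L.code k (d k)))) :
    False := by
  have key : ∀ k l : Set.Iio j, L.base ≤ k → ∀ hl : L.bound k ≤ l,
      L.tree.map (L.lt_bound k).le (d (L.bound k)) =
        L.tree.map ((L.lt_bound k).le.trans hl) (d l) := fun k l hk hl =>
    L.map_eq_map_of_sim hk hl (h _ _ (hk.trans (L.lt_bound k).le) hl)
  -- The node `d k` itself need not be coherent, as its own label is not yet visible at depth `k +
  -- 2`. The branch therefore uses the restriction of `d (bound k)` to height `k`. Heights below
  -- `base` are filled in by restriction.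
  let e : ∀ k : Set.Iio j, L.tree.level (max k L.base) := fun k =>
    L.tree.map (L.lt_bound (max k L.base)).le (d (L.bound (max k L.base)))
  apply L.noBranch
  -- Both components are restrictions of the single node `d` at the larger of the two bounds.
  refine ⟨fun k => L.tree.map (le_max_left k L.base) (e k), fun k l hkl => ?_⟩
  have h1 := key (max k L.base) (max (L.bound (max k L.base)) (L.bound (max l L.base)))
    (le_max_right _ _) (le_max_left _ _)
  have h2 := key (max l L.base) (max (L.bound (max k L.base)) (L.bound (max l L.base)))
    (le_max_right _ _) (le_max_right _ _)
  simp only [e]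
  rw [h1, h2]
  simp only [L.tree.map_comp]

theorem code_sizeLT (hκ : ∀ c : Cardinal.{u}, κ = (c : WithTop Cardinal.{u}) → c.IsRegular)
    (hj : ∀ i < j, SizeLT κ (Set.Iio i)) (l : Set.Iio j) (d : L.tree.level l) :
    SizeLT κ (L.code l d) := by
  classical
  refine SizeLT.union hκ ?_ (L.bottoms_sizeLT.image _)
  refine ((hj l l.2).image fun i => if h : i < (l : Ordinal.{u}) then
    insert i (L.label ⟨i, h.trans l.2⟩ (L.tree.map (show ⟨i, h.trans l.2⟩ ≤ l from h.le) d))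
      else ∅).mono ?_
  rintro _ ⟨i, hi, -, rfl⟩
  exact ⟨i, hi, dif_pos (show (i : Ordinal.{u}) < l from hi)⟩

theorem small_code (hκ : ∀ c : Cardinal.{u}, κ = (c : WithTop Cardinal.{u}) → c.IsRegular)
    (hj : ∀ i < j, SizeLT κ (Set.Iio i)) (l : Set.Iio j) (d : L.tree.level l) :
    Small κ j (two (L.code l d)) := by
  have hins : ∀ (i : Set.Iio j) (s : Set Ordinal.{u}) (m : Set.Iio j),
      s ⊆ Set.Iio (m : Ordinal.{u}) → SizeLT κ (insert (i : Ordinal.{u}) s) ∧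
        insert (i : Ordinal.{u}) s ⊆ Set.Iio j := by
    intro i s m hs
    refine ⟨SizeLT.union hκ (SizeLT.of_subsingleton hκ Set.subsingleton_singleton)
      ((hj m m.2).mono hs), Set.insert_subset i.2 fun x hx =>
        lt_trans (show x < m from hs hx) m.2⟩
  refine ⟨L.code_sizeLT hκ hj l d, ?_⟩
  rintro _ (⟨i, hi, hbi, rfl⟩ | ⟨c, hc, rfl⟩)
  · exact hins _ _ _ (L.label_lt i hbi _)
  · exact hins _ _ _ (L.bottoms_lt c hc)

theorem small_range_code
    (hκ : ∀ c : Cardinal.{u}, κ = (c : WithTop Cardinal.{u}) → c.IsRegular)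
    (hj : ∀ i < j, SizeLT κ (Set.Iio i)) (l : Set.Iio j) :
    Small κ j (three (Set.range (L.code l))) := by
  refine ⟨?_, ?_⟩
  · rw [← Set.image_univ]
    exact (L.sizeLT l).image _
  · rintro _ ⟨d, rfl⟩
    exact L.small_code hκ hj l d

/-- One half restricts nodes from `l` to `k`. The other extends nodes from `k` to `l`, which is
where surjectivity of the tree maps enters. -/
theorem sim_range_code {k l : Set.Iio j} (hk : L.base ≤ k) (hkl : k ≤ l) :
    Sim (succ (succ (succ (k : Ordinal.{u})))) (three (Set.range (L.code l)))
      (three (Set.range (L.code k))) := by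
  apply sim_three_of
  · rintro _ ⟨d, rfl⟩
    exact ⟨_, ⟨_, rfl⟩, L.sim_code hk hkl d⟩
  · rintro _ ⟨d, rfl⟩
    obtain ⟨d', rfl⟩ := L.surj k l hkl d
    exact ⟨_, ⟨_, rfl⟩, L.sim_code hk hkl d'⟩

/-- The ghost has as its `k`-th component the projection of the set of all codes at height `max k
base`. A successor would pick, coherently over all heights, one code at each height, and hence yield
a full branch of the tree. -/
theorem exists_ghost (L : LabelledTree.{u, w} κ j)
    (hκ : ∀ c : Cardinal.{u}, κ = (c : WithTop Cardinal.{u}) → c.IsRegular)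
    (hj : ∀ i < j, SizeLT κ (Set.Iio i)) (hlim : IsSuccPrelimit j) :
    ∃ t : Raw j, IsElement κ j t ∧
      (∀ k (hk : succ k ≤ j), (members t k hk).Nonempty) ∧
      ∀ b : Raw j, IsElement (⊤ : WithTop Cardinal.{u}) j b →
        ¬ ∀ k (hk : k < j), rawConn j k hk.le b ∈ members t k (succ_le_of_lt hk) := by
  let m : ∀ k, k < j → Set.Iio j := fun k hk => max ⟨k, hk⟩ L.base
  have hm : ∀ k hk, k ≤ (m k hk : Ordinal.{u}) := fun k hk =>
    show (⟨k, hk⟩ : Set.Iio j) ≤ m k hk from le_max_left _ _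
  have hmono : ∀ k l (hkl : k ≤ l) (hl : l < j), m k (hkl.trans_lt hl) ≤ m l hl :=
    fun k l hkl hl => max_le_max (show (⟨k, _⟩ : Set.Iio j) ≤ ⟨l, hl⟩ from hkl) le_rfl
  obtain ⟨t, ht, htk⟩ := exists_isElement_of_compatible (κ := κ) hlim
    (fun k hk => rawProj Step k (three (Set.range (L.code (m k hk)))))
    (fun k hk => (L.small_range_code hκ hj _).isElement hj k)
    (fun k l hkl hl => by
      rw [rawConn_rawProj, rawProj_eq_iff_approx]
      refine Approx.mono ?_ (L.sim_range_code (le_max_right _ _) (hmono k l hkl hl))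
      exact (hm k _).trans ((le_succ _).trans ((le_succ _).trans (le_succ _))))
  have hmem : ∀ k (hk : succ k ≤ j), members t k hk =
      rawProj Step k '' {y | ∃ d, y = two (L.code (m (succ k) (hlim.succ_lt
        (succ_le_iff.1 hk))) d)} := by
    intro k hk
    rw [members, htk _ (hlim.succ_lt (succ_le_iff.1 hk)), rawProj_succ, Equiv.apply_symm_apply]
    congr 1
    ext y
    constructor
    · rcases y with _ | _ | y | _
      · exact False.elim
      · exact False.elim
      · rintro ⟨d, rfl⟩
        exact ⟨d, rfl⟩
      · exact False.elim
    · rintro ⟨d, rfl⟩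
      exact ⟨d, rfl⟩
  refine ⟨t, ht, fun k hk => ?_, fun b hb hbt => ?_⟩
  · obtain ⟨d⟩ := L.nonempty (m (succ k) (hlim.succ_lt (succ_le_iff.1 hk)))
    rw [hmem]
    exact ⟨_, _, ⟨d, rfl⟩, rfl⟩
  · have hs2 : ∀ k : Set.Iio j, succ (succ (k : Ordinal.{u})) < j := fun k =>
      hlim.succ_lt (hlim.succ_lt k.2)
    -- Level `k + 2` is the depth to which the code of a node at height `k` is faithful. The code
    -- supplied by `b` at this level belongs to a higher node, which is restricted to height `k`.
    -- Below `base` any node will do.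
    have hex : ∀ k : Set.Iio j, ∃ d : L.tree.level k, L.base ≤ k →
        rawConn j _ (hs2 k).le b = rawProj Step _ (two (L.code k d)) := by
      intro k
      by_cases hk : L.base ≤ k
      · have h := hbt _ (hs2 k)
        rw [hmem] at h
        obtain ⟨_, ⟨d, rfl⟩, h⟩ := h
        have hkm : k ≤ m _ (hlim.succ_lt (hs2 k)) := by
          refine le_trans (α := Ordinal.{u}) ?_ (hm _ _)
          exact (le_succ _).trans ((le_succ _).trans (le_succ _))
        refine ⟨L.tree.map hkm d, fun _ => ?_⟩
        rw [← h, rawProj_eq_iff_approx]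
        exact L.sim_code hk hkm d
      · obtain ⟨d⟩ := L.nonempty k
        exact ⟨d, fun h => absurd h hk⟩
    choose d hd using hex
    refine L.not_forall_sim d fun k l hk hkl => ?_
    have h1 := hd k hk
    have h2 := hd l (hk.trans hkl)
    rw [Sim, ← rawProj_eq_iff_approx, ← h1,
      ← hb.rawConn_rawConn (succ_le_succ (succ_le_succ hkl)) (hs2 l).le, h2, rawConn_rawProj]

end LabelledTree

/-- A tidy tree of regular height with small levels and no full branch can be labelled. -/
theorem exists_labelledTree_of_not_treeProperty {κ : WithTop Cardinal.{u}} {c : Cardinal.{u}}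
    (hc : c.IsRegular) (ht : ¬ TreeProperty c)
    (hκ : ∀ c' : Cardinal.{u}, κ = (c' : WithTop Cardinal.{u}) → c'.IsRegular)
    (hcκ : ∀ c' : Cardinal.{u}, κ = (c' : WithTop Cardinal.{u}) → c ≤ c') :
    Nonempty (LabelledTree.{u, u} κ c.ord) := by
  simp only [TreeProperty, not_forall] at ht
  obtain ⟨D, htidy, hsmall, hbr⟩ := ht
  have hprin := Ordinal.isPrincipal_add_ord hc.aleph0_le
  have hlim : IsSuccLimit c.ord := Cardinal.isSuccLimit_ord hc.aleph0_le
  have hα : ∀ k, ∃ α : D.level k → Ordinal.{u}, Function.Injective α ∧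
      ∀ d, α d < (Cardinal.mk (D.level k)).ord := by
    intro k
    obtain ⟨r, wo, e⟩ := Cardinal.exists_ord_eq (D.level k)
    exact ⟨fun d => Ordinal.typein r d, Ordinal.typein_injective r,
      fun d => e ▸ Ordinal.typein_lt_type r d⟩
  choose α hinj hlt using hα
  have hle : ∀ (k : Ordinal.{u}) d, k < succ k + d := fun k d =>
    (lt_succ k).trans_le le_self_add
  refine ⟨{
    tree := D
    surj := htidy.surj
    nonempty := fun k => ?_
    noBranch := hbr
    sizeLT := fun k c' hc' => ?_
    base := ⟨0, hc.ord_pos⟩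
    bottoms := {∅}
    bottoms_lt := fun s hs => by
      rw [Set.mem_singleton_iff.1 hs]
      exact Set.empty_subset _
    bottoms_sizeLT := SizeLT.of_subsingleton hκ Set.subsingleton_singleton
    -- The labels at height `k` are singletons in the interval from `k + 1` up to this bound. They
    -- have empty bottom part, and the bound stays below `c.ord` because that ordinal is closed
    -- under addition.
    bound := fun k => ⟨succ (k : Ordinal.{u}) + (Cardinal.mk (D.level k)).ord,
      hprin (hlim.succ_lt k.2) (Cardinal.ord_lt_ord.2 (hsmall k))⟩
    lt_bound := fun k => hle _ _
    label := fun k d => {succ (k : Ordinal.{u}) + α k d}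
    label_injective := fun k d d' h =>
      hinj k (add_left_cancel (Set.singleton_injective h))
    label_inter := fun k _ d => ?_
    notMem_label := fun k _ d h => (hle _ _).ne (Set.mem_singleton_iff.1 h)
    label_lt := fun k _ d x hx => ?_ }⟩
  · obtain ⟨i, hi, ⟨d⟩⟩ := htidy.root
    obtain ⟨d', -⟩ := htidy.surj i k (hi k) d
    exact ⟨d'⟩
  · rw [Cardinal.mk_univ, Cardinal.lift_lt]
    exact (hsmall k).trans_le (hcκ c' hc')
  · rw [Set.mem_singleton_iff]
    ext x
    simp only [Set.mem_inter_iff, Set.mem_singleton_iff, Set.mem_Iio, Set.mem_empty_iff_false,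
      iff_false, not_and, not_lt]
    rintro rfl
    exact (hle _ _).le
  · rw [Set.mem_singleton_iff.1 hx]
    exact (add_lt_add_iff_left _).2 (hlt k d)

open Classical in
/-- The tree of finite subsets of `C` with exactly one element that is not below the height. -/
noncomputable def finsetTree {I : Type v} [LinearOrder I] (C : Set I) : InverseChain.{v, v} I where
  level l := {d : Finset C // (∃ x ∈ d, l ≤ x.1) ∧ ∀ x ∈ d, ∀ y ∈ d, y < x → y.1 < l}
  map {k l} h d := ⟨d.1.filter fun x => ∀ y ∈ d.1, y < x → y.1 < k, by
    constructor
    · obtain ⟨x, hx, hlx⟩ := d.2.1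
      -- Restriction to `k` keeps the elements below `k` and the least element not below `k`.
      obtain ⟨y, hy, hmin⟩ := (d.1.filter fun x => k ≤ x.1).exists_min_image id
        ⟨x, Finset.mem_filter.2 ⟨hx, h.trans hlx⟩⟩
      rw [Finset.mem_filter] at hy
      refine ⟨y, Finset.mem_filter.2 ⟨hy.1, fun z hz hzy => ?_⟩, hy.2⟩
      by_contra hkz
      exact absurd (hmin z (Finset.mem_filter.2 ⟨hz, not_lt.1 hkz⟩)) hzy.not_ge
    · intro x hx y hy hyx
      exact (Finset.mem_filter.1 hx).2 y (Finset.mem_filter.1 hy).1 hyx⟩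
  map_id l d := Subtype.ext (Finset.filter_true_of_mem d.2.2)
  map_comp {m k l} hmk hkl d := by
    apply Subtype.ext
    ext x
    simp only [Finset.mem_filter]
    constructor
    · rintro ⟨⟨hx, hxk⟩, hxm⟩
      exact ⟨hx, fun y hy hyx => hxm y ⟨hy, fun z hz hzy => hxk z hz (hzy.trans hyx)⟩ hyx⟩
    · rintro ⟨hx, hxm⟩
      exact ⟨⟨hx, fun y hy hyx => (hxm y hy hyx).trans_le hmk⟩, fun y hy hyx => hxm y hy.1 hyx⟩

/-- If the top element of a node already reaches `l`, the node lifts to itself. Otherwise it is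
extended by one element of `C` not below `l`, which restriction to `k` discards. -/
theorem finsetTree_surjective {I : Type v} [LinearOrder I] {C : Set I} (hC : IsCofinal C)
    (k l : I) (h : k ≤ l) : Function.Surjective ((finsetTree C).map h) := by
  classical
  rintro ⟨d, ⟨m, hm, hkm⟩, hd⟩
  have hmax : ∀ x ∈ d, x ≤ m := by
    intro x hx
    by_contra hlt
    exact absurd (hd x hx m hm (not_le.1 hlt)) hkm.not_gt
  have hlow : ∀ x ∈ d, x ≠ m → x.1 < k := fun x hx hne =>
    hd m hm x hx (lt_of_le_of_ne (hmax x hx) hne)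
  by_cases hlm : l ≤ m.1
  · refine ⟨⟨d, ⟨m, hm, hlm⟩, fun x hx y hy hyx => (hd x hx y hy hyx).trans_le h⟩, ?_⟩
    apply Subtype.ext
    exact Finset.filter_true_of_mem hd
  · obtain ⟨c, hc, hlc⟩ := hC l
    have hlt : ∀ x ∈ d, x.1 < l := fun x hx => lt_of_le_of_lt (hmax x hx) (not_le.1 hlm)
    refine ⟨⟨insert ⟨c, hc⟩ d, ⟨⟨c, hc⟩, Finset.mem_insert_self _ _, hlc⟩, ?_⟩, ?_⟩
    · intro x hx y hy hyx
      rcases Finset.mem_insert.1 hy with rfl | hy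
      · rcases Finset.mem_insert.1 hx with rfl | hx
        · exact absurd hyx (lt_irrefl _)
        · exact absurd ((show c < x.1 from hyx).trans (hlt x hx)) hlc.not_gt
      · exact hlt y hy
    · apply Subtype.ext
      ext x
      simp only [finsetTree, Finset.mem_filter, Finset.mem_insert]
      constructor
      · rintro ⟨rfl | hx, hx'⟩
        · exact absurd (hx' m (Or.inr hm) ((hlt m hm).trans_le hlc)) hkm.not_gt
        · exact hx
      · intro hx
        refine ⟨Or.inr hx, ?_⟩
        rintro y (rfl | hy) hyx
        · exact absurd ((show c < x.1 from hyx).trans (hlt x hx)) hlc.not_gt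
        · exact hd x hx y hy hyx

theorem finsetTree_nonempty {I : Type v} [LinearOrder I] {C : Set I} (hC : IsCofinal C)
    (l : I) : Nonempty ((finsetTree C).level l) := by
  obtain ⟨c, hc, hlc⟩ := hC l
  refine ⟨⟨{⟨c, hc⟩}, ⟨_, Finset.mem_singleton_self _, hlc⟩, ?_⟩⟩
  intro x hx y hy hyx
  rw [Finset.mem_singleton] at hx hy
  subst hx hy
  exact absurd hyx (lt_irrefl _)

/-- Repeatedly passing just beyond the top element of the current node gives an increasing
`ω`-sequence of heights. Without `ω`-cofinality it is bounded by some `l < j`, and then the finite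
node at `l` contains infinitely many elements. -/
theorem finsetTree_not_hasFullBranch {j : Ordinal.{u}} (hj : IsSuccPrelimit j) (h0 : j ≠ 0)
    (hω : ¬ OmegaCofinal j) (C : Set (Set.Iio j)) : ¬ (finsetTree C).HasFullBranch := by
  rintro ⟨x, hx⟩
  choose m hm using fun l => (x l).2.1
  let s : ℕ → Set.Iio j := fun n => Nat.rec ⟨0, pos_iff_ne_zero.2 h0⟩
    (fun _ l => ⟨succ ((m l).1 : Ordinal.{u}), hj.succ_lt (m l).1.2⟩) n
  have hs : ∀ n, (s (n + 1) : Ordinal.{u}) = succ ((m (s n)).1 : Ordinal.{u}) := fun _ => rfl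
  have hlt : ∀ n, (m (s n)).1 < s (n + 1) := fun n =>
    show ((m (s n)).1 : Ordinal.{u}) < s (n + 1) by rw [hs]; exact lt_succ _
  have hmono : StrictMono s := strictMono_nat_of_lt_succ fun n =>
    (hm (s n)).2.trans_lt (hlt n)
  have hub : ∃ l : Set.Iio j, ∀ n, s n ≤ l := by
    by_contra hno
    push Not at hno
    apply hω
    refine ⟨fun n => (s n).1, ?_, ?_, fun l hl => ?_⟩
    · intro a b hab
      exact hmono hab
    · rintro _ ⟨n, rfl⟩
      exact (s n).2.le
    · by_contra hlj
      obtain ⟨n, hn⟩ := hno ⟨l, not_le.1 hlj⟩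
      exact absurd (hl ⟨n, rfl⟩) (not_le.2 hn)
  obtain ⟨l, hl⟩ := hub
  refine Set.infinite_of_injective_forall_mem (s := (↑(x l).1 : Set C)) (f := fun n => m (s n))
    ?_ ?_ (Finset.finite_toSet _)
  · apply StrictMono.injective
    refine strictMono_nat_of_lt_succ fun n => ?_
    exact (hlt n).trans_le (hm (s (n + 1))).2
  · intro n
    have h1 := (hm (s n)).1
    rw [← hx _ _ (hl n)] at h1
    simp only [finsetTree, Finset.mem_filter] at h1
    exact h1.1

/-- The finite subsets of a cofinal set of size `j.cof` number at most `2 ^ μ`, so each can be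
labelled by a subset of `μ`. With `base = μ` a label is its own bottom part. The family of bottoms
is small because `j.cof ≤ j.card < κ`. -/
theorem exists_labelledTree_of_cof_le {κ : WithTop Cardinal.{u}} {j μ : Ordinal.{u}}
    (hj : IsSuccPrelimit j) (h0 : j ≠ 0) (hω : ¬ OmegaCofinal j) (hμ : μ < j)
    (hcof : j.cof ≤ 2 ^ μ.card)
    (hjκ : ∀ c : Cardinal.{u}, κ = (c : WithTop Cardinal.{u}) → j < c.ord) :
    Nonempty (LabelledTree.{u, u + 1} κ j) := by
  have hlim : IsSuccLimit j := ⟨by rwa [isMin_iff_eq_bot], hj⟩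
  obtain ⟨C, hC, hmk⟩ := Order.exists_cof_eq (Set.Iio j)
  rw [Ordinal.cof_Iio, ← Ordinal.lift_cof] at hmk
  have hinf : Infinite C := by
    rw [← Cardinal.aleph0_le_mk_iff, hmk, Cardinal.aleph0_le_lift]
    exact (Cardinal.isRegular_cof hlim).aleph0_le
  have hfin := Cardinal.mk_finset_of_infinite C
  have hemb : Nonempty (Finset C ↪ Set (Set.Iio μ)) := by
    rw [← Cardinal.le_def, hfin, hmk, Cardinal.mk_set, Cardinal.mk_Iio_ordinal,
      ← Cardinal.lift_two_power, Cardinal.lift_le]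
    exact hcof
  obtain ⟨e⟩ := hemb
  have hsize : SizeLT κ (Set.univ : Set (Finset C)) := by
    intro c hc
    rw [Cardinal.mk_univ, hfin, hmk, Cardinal.lift_lift, Cardinal.lift_lt]
    exact (Ordinal.cof_le_card j).trans_lt (Cardinal.lt_ord.1 (hjκ c hc))
  let f : Finset C → Set Ordinal.{u} := fun d => Subtype.val '' e d
  have hf : ∀ d, f d ⊆ Set.Iio μ := by
    rintro d _ ⟨x, -, rfl⟩
    exact x.2
  have hfi : Function.Injective f := fun d d' h =>
    e.injective (Set.image_injective.2 Subtype.val_injective h)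
  refine ⟨{
    tree := finsetTree C
    surj := finsetTree_surjective hC
    nonempty := finsetTree_nonempty hC
    noBranch := finsetTree_not_hasFullBranch hj h0 hω C
    sizeLT := fun k => ?_
    base := ⟨μ, hμ⟩
    bottoms := Set.range f
    bottoms_lt := by
      rintro _ ⟨d, rfl⟩
      exact hf d
    bottoms_sizeLT := by
      rw [← Set.image_univ]
      exact hsize.image f
    bound := fun k => ⟨succ (k : Ordinal.{u}), hj.succ_lt k.2⟩
    lt_bound := fun k => lt_succ (k : Ordinal.{u})
    label := fun k d => f d.1
    label_injective := fun k d d' h => Subtype.ext (hfi h)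
    label_inter := fun k hk d => ⟨d.1, ?_⟩
    notMem_label := fun k hk d h => (hf _ h).not_ge hk
    label_lt := fun k hk d x hx => ?_ }⟩
  · intro c hc
    refine lt_of_le_of_lt (Cardinal.lift_le.2 ?_) (hsize c hc)
    rw [Cardinal.mk_univ, Cardinal.mk_univ]
    exact Cardinal.mk_le_of_injective (f := fun d : (finsetTree C).level k => d.1)
      Subtype.val_injective
  · exact (Set.inter_eq_left.2 fun x hx =>
      lt_of_lt_of_le (hf _ hx) (show μ ≤ (k : Ordinal.{u}) from hk)).symm
  · exact lt_trans (lt_of_lt_of_le (hf _ hx) (show μ ≤ (k : Ordinal.{u}) from hk))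
      (lt_succ (k : Ordinal.{u}))

/-- At a limit which is not extensible there is an element which looks nonempty but has no
successors. -/
theorem exists_ghost {κ : WithTop Cardinal.{u}}
    (hκ : ∀ c : Cardinal.{u}, κ = (c : WithTop Cardinal.{u}) → c.IsRegular) {j : Ordinal.{u}}
    (hj : IsSuccPrelimit j) (hext : ¬ Extensible κ j) :
    j ≠ 0 ∧ ∃ t : Raw j, IsElement κ j t ∧
      (∀ k (hk : succ k ≤ j), (members t k hk).Nonempty) ∧
      ∀ b : Raw j, IsElement (⊤ : WithTop Cardinal.{u}) j b →
        ¬ ∀ k (hk : k < j), rawConn j k hk.le b ∈ members t k (succ_le_of_lt hk) := by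
  simp only [Extensible, not_or, not_exists, not_and] at hext
  obtain ⟨h0, hω, hwc, hbig, htp⟩ := hext
  have hlim : IsSuccLimit j := ⟨by rwa [isMin_iff_eq_bot], hj⟩
  -- A limit strictly above `κ` is at least `κ + ω`, hence extensible.
  have hle : ∀ c : Cardinal.{u}, κ = (c : WithTop Cardinal.{u}) → j ≤ c.ord := by
    intro c hc
    by_contra hlt
    refine hbig c hc hlim (Ordinal.add_le_iff_of_isSuccLimit Ordinal.isSuccLimit_omega0 |>.2 ?_)
    intro n hn
    obtain ⟨n, rfl⟩ := Ordinal.lt_omega0.1 hn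
    exact (hj.add_natCast_lt (not_le.1 hlt) n).le
  have hIio : ∀ i < j, SizeLT κ (Set.Iio i) := fun i hi =>
    SizeLT.Iio fun c hc => hi.trans_le (hle c hc)
  refine ⟨h0, ?_⟩
  -- If `j` is singular, take `μ` to be its cofinality; `j = κ` is excluded by regularity of `κ`.
  -- Otherwise `j` is a regular cardinal.
  rcases (Ordinal.ord_cof_le j).lt_or_eq with hlt | heq
  · obtain ⟨L⟩ := exists_labelledTree_of_cof_le (κ := κ) hj h0 hω hlt
      (by rw [Cardinal.card_ord]; exact (Cardinal.cantor _).le) fun c hc =>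
        lt_of_le_of_ne (hle c hc) fun e => by
          subst e
          rw [(hκ c hc).cof_ord] at hlt
          exact lt_irrefl _ hlt
    exact L.exists_ghost hκ hIio hj
  · have hreg : j.cof.IsRegular := Cardinal.isRegular_cof hlim
    generalize j.cof = c at heq hreg
    subst heq
    by_cases ht : TreeProperty c
    -- With the tree property but without weak compactness, some `μ < c` has `c ≤ 2 ^ μ`. Here `j =
    -- κ` is excluded because `κ` with the tree property is extensible.
    · have hni : ¬ ∀ A : Type u, Cardinal.mk A < c → Cardinal.mk (Set A) < c := fun h =>
        hwc c ⟨hreg, h, ht⟩ rfl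
      push Not at hni
      obtain ⟨A, hA, hA'⟩ := hni
      obtain ⟨L⟩ := exists_labelledTree_of_cof_le (κ := κ) hj h0 hω (Cardinal.ord_lt_ord.2 hA)
        (by rw [Cardinal.card_ord, hreg.cof_ord, ← Cardinal.mk_set]; exact hA') fun c' hc' =>
          lt_of_le_of_ne (hle c' hc') fun e => by
            obtain rfl := Cardinal.ord_injective e
            exact htp _ hc' rfl ht
      exact L.exists_ghost hκ hIio hj
    · obtain ⟨L⟩ := exists_labelledTree_of_not_treeProperty hreg ht hκ fun c' hc' =>
        Cardinal.ord_le_ord.1 (hle c' hc')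
      exact L.exists_ghost hκ hIio hj

/-! ## The tree property for large index universes -/

theorem small_of_mk_lt_lift {α : Type (u + 1)} {c : Cardinal.{u}}
    (h : Cardinal.mk α < Cardinal.lift.{u + 1} c) : Small.{u} α := by
  obtain ⟨m, -, hm⟩ := Cardinal.lt_lift_iff.1 h
  rw [← Cardinal.mk_out m, ← Cardinal.mk_uLift] at hm
  obtain ⟨f⟩ := Cardinal.eq.1 hm
  exact ⟨m.out, ⟨f.symm.trans Equiv.ulift⟩⟩

theorem SizeLT.mk_lt {c : Cardinal.{u}} {X : Type (u + 1)} {s : Set X}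
    (hs : SizeLT (c : WithTop Cardinal.{u}) s) : Cardinal.mk s < Cardinal.lift.{u + 1} c := by
  have h := hs c rfl
  rwa [Cardinal.lift_id'.{u, u + 1}] at h

/-- Levels of size less than `c` are equivalent to types in the lower universe, so the tree can be
replaced by an isomorphic one to which `TreeProperty` applies. -/
theorem InverseChain.IsTidyTree.hasFullBranch {c : Cardinal.{u}} (hc : TreeProperty c)
    {D : InverseChain.{u + 1, u + 1} (Set.Iio c.ord)} (hD : D.IsTidyTree)
    (hsize : ∀ i, Cardinal.mk (D.level i) < Cardinal.lift.{u + 1} c) :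
    D.HasFullBranch := by
  have hs : ∀ i, Small.{u} (D.level i) := fun i => small_of_mk_lt_lift (hsize i)
  let E : InverseChain.{u + 1, u} (Set.Iio c.ord) :=
    { level := fun i => Shrink.{u} (D.level i)
      map := fun {j i} h x => equivShrink _ (D.map h ((equivShrink _).symm x))
      map_id := fun i x => by rw [D.map_id, Equiv.apply_symm_apply]
      map_comp := fun hkj hji x => by rw [Equiv.symm_apply_apply, D.map_comp] }
  have hE : E.IsTidyTree :=
    { surj := fun j i h y => by
        obtain ⟨x, hx⟩ := hD.surj j i h ((equivShrink _).symm y)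
        refine ⟨equivShrink _ x, ?_⟩
        simp only [E, Equiv.symm_apply_apply, hx, Equiv.apply_symm_apply]
      limit := fun i hi x y h => by
        apply (equivShrink (D.level i)).symm.injective
        exact hD.limit i hi _ _ fun j hj => (equivShrink _).injective (h j hj)
      root := by
        obtain ⟨i, hi, ⟨x⟩⟩ := hD.root
        exact ⟨i, hi, ⟨equivShrink _ x⟩⟩ }
  obtain ⟨x, hx⟩ := hc E hE fun i => by
    have h : Cardinal.lift.{u + 1} (Cardinal.mk (E.level i)) = Cardinal.mk (D.level i) := by
      rw [← Cardinal.mk_uLift]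
      exact Cardinal.mk_congr (Equiv.ulift.trans (equivShrink _).symm)
    rw [← Cardinal.lift_lt.{_, u + 1}, h]
    exact hsize i
  refine ⟨fun i => (equivShrink _).symm (x i), fun j i h => ?_⟩
  exact (Equiv.eq_symm_apply _).2 (hx j i h)

/-! ## Successors at extensible limits -/

section Members

variable {κ : WithTop Cardinal.{u}} {i : Ordinal.{u}} {a : Raw i}

theorem exists_lift_members (ha : IsElement κ i a) {k l : Ordinal.{u}} (hkl : k ≤ l)
    (hl : succ l ≤ i) {e : Raw k} (he : e ∈ members a k ((succ_le_succ hkl).trans hl)) :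
    ∃ d ∈ members a l hl, rawConn l k hkl d = e := by
  rw [← members_image ha hkl hl] at he
  exact he

theorem rawConn_mem_members (ha : IsElement κ i a) {k l : Ordinal.{u}} (hkl : k ≤ l)
    (hl : succ l ≤ i) {d : Raw l} (hd : d ∈ members a l hl) :
    rawConn l k hkl d ∈ members a k ((succ_le_succ hkl).trans hl) := by
  rw [← members_image ha hkl hl]
  exact ⟨d, hd, rfl⟩

/-- A coherent family of members yields a successor. -/
theorem exists_branch_of_coherent (hi : IsSuccPrelimit i) (ha : IsElement κ i a)
    (m : Ordinal.{u} → Ordinal.{u}) (hm : ∀ l, l ≤ m l) (hmi : ∀ l < i, m l < i)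
    (x : ∀ l, Raw (m l)) (hx : ∀ l (hl : l < i), x l ∈ members a (m l) (succ_le_of_lt (hmi l hl)))
    (hc : ∀ k l (hkl : k ≤ l), l < i →
      rawConn (m l) k (hkl.trans (hm l)) (x l) = rawConn (m k) k (hm k) (x k)) :
    ∃ b : Raw i, IsElement κ i b ∧
      (∀ l (hl : l < i), rawConn i l hl.le b ∈ members a l (succ_le_of_lt hl)) ∧
      ∀ l (hl : l < i), rawConn i l hl.le b = rawConn (m l) l (hm l) (x l) := by
  have hel : ∀ l (hl : l < i), IsElement κ (m l) (x l) := fun l hl =>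
    isElement_of_mem_members ha _ (hx l hl)
  obtain ⟨b, hb, hbl⟩ := exists_isElement_of_compatible hi
    (fun l _ => rawConn (m l) l (hm l) (x l)) (fun l hl => (hel l hl).rawConn _)
    (fun k l hkl hl => by rw [(hel l hl).rawConn_rawConn, hc k l hkl hl])
  refine ⟨b, hb, fun l hl => ?_, hbl⟩
  rw [hbl l hl]
  exact rawConn_mem_members ha (hm l) _ (hx l hl)

/-- Members are lifted step by step along a cofinal `ω`-sequence starting above `k`. No limit stage
is met on the way, and the remaining components are restrictions. -/
theorem exists_branch_of_omegaCofinal (hi : IsSuccPrelimit i) (hω : OmegaCofinal i)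
    (ha : IsElement κ i a) {k : Ordinal.{u}} (hk : k < i) {e : Raw k}
    (he : e ∈ members a k (succ_le_of_lt hk)) :
    ∃ b : Raw i, IsElement κ i b ∧
      (∀ l (hl : l < i), rawConn i l hl.le b ∈ members a l (succ_le_of_lt hl)) ∧
      rawConn i k hk.le b = e := by
  obtain ⟨f, hf, hlub⟩ := hω
  have hfi : ∀ n, f n < i := fun n => (hf n.lt_succ_self).trans_le (hlub.1 ⟨_, rfl⟩)
  have hcof : ∀ l < i, ∃ n, l ≤ f n := by
    intro l hl
    by_contra hno
    push Not at hno
    refine absurd (hlub.2 ?_) hl.not_ge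
    rintro _ ⟨n, rfl⟩
    exact (hno n).le
  obtain ⟨N, hN⟩ := hcof k hk
  let g : ℕ → Ordinal.{u} := fun n => f (N + n)
  have hg : Monotone g := fun m n hmn => hf.monotone (Nat.add_le_add_left hmn N)
  have hgi : ∀ n, g n < i := fun n => hfi _
  obtain ⟨e0, he0, hee⟩ := exists_lift_members ha hN (succ_le_of_lt (hfi N)) he
  let S : ℕ → Type (u + 1) := fun n => {d : Raw (g n) // d ∈ members a (g n)
    (succ_le_of_lt (hgi n))}
  have hstep : ∀ n (d : S n), ∃ d' : S (n + 1), rawConn _ _ (hg n.le_succ) d'.1 = d.1 := by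
    rintro n ⟨d, hd⟩
    obtain ⟨d', hd', h⟩ := exists_lift_members ha (hg n.le_succ) (succ_le_of_lt (hgi _)) hd
    exact ⟨⟨d', hd'⟩, h⟩
  choose next hnext using hstep
  let s : ∀ n, S n := fun n => Nat.rec ⟨e0, he0⟩ next n
  have hel : ∀ n, IsElement κ (g n) (s n).1 := fun n => isElement_of_mem_members ha _ (s n).2
  have hs : ∀ m n (h : m ≤ n), rawConn _ _ (hg h) (s n).1 = (s m).1 := by
    intro m n h
    induction n, h using Nat.le_induction with
    | base => exact rawConn_self _ _
    | succ n h ih =>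
      rw [← (hel (n + 1)).rawConn_rawConn (hg h) (hg n.le_succ),
        show rawConn _ _ (hg n.le_succ) (s (n + 1)).1 = (s n).1 from hnext n (s n), ih]
  have hcoh : ∀ l m n (hm : l ≤ g m) (hn : l ≤ g n),
      rawConn _ l hm (s m).1 = rawConn _ l hn (s n).1 := by
    intro l m n hm hn
    rcases le_total m n with h | h
    · rw [← hs m n h, (hel n).rawConn_rawConn]
    · rw [← hs n m h, (hel m).rawConn_rawConn]
  have hcof' : ∀ l, ∃ n, l < i → l ≤ g n := by
    intro l
    by_cases hl : l < i
    · obtain ⟨n, hn⟩ := hcof l hl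
      exact ⟨n, fun _ => hn.trans (hf.monotone (Nat.le_add_left n N))⟩
    · exact ⟨0, fun h => absurd h hl⟩
  choose p hp using hcof'
  have hel' : ∀ l (hl : l < i), IsElement κ l (rawConn _ l (hp l hl) (s (p l)).1) :=
    fun l hl => (hel _).rawConn _
  obtain ⟨b, hb, hbl⟩ := exists_isElement_of_compatible hi
    (fun l hl => rawConn _ l (hp l hl) (s (p l)).1) hel'
    (fun k l hkl hl => by rw [(hel _).rawConn_rawConn]; exact hcoh _ _ _ _ _)
  refine ⟨b, hb, fun l hl => ?_, ?_⟩
  · rw [hbl l hl]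
    exact rawConn_mem_members ha (hp l hl) _ (s (p l)).2
  · rw [hbl k hk, hcoh k (p k) 0 _ hN]
    exact hee

theorem exists_branch_of_treeProperty {c : Cardinal.{u}} (hc : c.IsRegular) (ht : TreeProperty c)
    {a : Raw c.ord} (ha : IsElement κ c.ord a)
    (hsize : ∀ l (hl : succ l ≤ c.ord), Cardinal.mk (members a l hl) < Cardinal.lift.{u + 1} c)
    {k : Ordinal.{u}} (hk : k < c.ord) {e : Raw k} (he : e ∈ members a k (succ_le_of_lt hk)) :
    ∃ b : Raw c.ord, IsElement κ c.ord b ∧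
      (∀ l (hl : l < c.ord), rawConn c.ord l hl.le b ∈ members a l (succ_le_of_lt hl)) ∧
      rawConn c.ord k hk.le b = e := by
  have hi : IsSuccLimit c.ord := Cardinal.isSuccLimit_ord hc.aleph0_le
  have hee := isElement_of_mem_members ha _ he
  have hel : ∀ {l} (hl : l < c.ord) {d : Raw l}, d ∈ members a l (succ_le_of_lt hl) →
    IsElement κ l d := fun hl d hd => isElement_of_mem_members ha _ hd
  -- The subtree of members comparable with `e`: up to level `k` its only nodes are the restrictions
  -- of `e`, and above `k` its nodes are the members extending `e`.
  let S : Set.Iio c.ord → Type (u + 1) := fun l =>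
    {d : Raw l // d ∈ members a l (succ_le_of_lt l.2) ∧
      ∀ m (hm : m ≤ (l : Ordinal.{u})) (hmk : m ≤ k), rawConn l m hm d = rawConn k m hmk e}
  let D : InverseChain.{u + 1, u + 1} (Set.Iio c.ord) :=
    { level := S
      map := fun {j l} (h : j ≤ l) x => ⟨rawConn l j h x.1,
        rawConn_mem_members ha h (succ_le_of_lt l.2) x.2.1, fun m hm hmk => by
          rw [(hel l.2 x.2.1).rawConn_rawConn, x.2.2]⟩
      map_id := fun l x => Subtype.ext (rawConn_self _ _)
      map_comp := fun {k j l} hkj hjl x => Subtype.ext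
        ((hel l.2 x.2.1).rawConn_rawConn (show (k : Ordinal.{u}) ≤ j from hkj) hjl) }
  have hD : D.IsTidyTree :=
    { surj := by
        rintro ⟨j, hj⟩ ⟨l, hl⟩ (h : j ≤ l) ⟨d, hd, hdm⟩
        rcases le_total l k with hlk | hkl
        · refine ⟨⟨rawConn k l hlk e, rawConn_mem_members ha hlk _ he, fun m hm hmk =>
            hee.rawConn_rawConn _ _⟩, Subtype.ext ?_⟩
          exact (hee.rawConn_rawConn h hlk).trans
            ((hdm j le_rfl (h.trans hlk)).symm.trans (rawConn_self j d))
        · rcases le_total j k with hjk | hkj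
          · obtain ⟨d', hd', h'⟩ := exists_lift_members ha hkl (succ_le_of_lt hl) he
            refine ⟨⟨d', hd', fun m hm hmk => ?_⟩, Subtype.ext ?_⟩
            · rw [← h', (hel hl hd').rawConn_rawConn]
            · refine Eq.trans ?_ ((hdm j le_rfl hjk).symm.trans (rawConn_self j d))
              exact ((hel hl hd').rawConn_rawConn hjk hkl).symm.trans (congrArg _ h')
          · obtain ⟨d', hd', h'⟩ := exists_lift_members ha h (succ_le_of_lt hl) hd
            refine ⟨⟨d', hd', fun m hm hmk => ?_⟩, Subtype.ext h'⟩
            rw [← hdm m (hmk.trans hkj) hmk, ← h', (hel hl hd').rawConn_rawConn]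
      limit := by
        rintro ⟨l, hl⟩ hlim x y h
        apply Subtype.ext
        have hlim' : IsSuccPrelimit l := by
          intro m hml
          refine hlim ⟨m, hml.1.trans hl⟩ ⟨hml.1, ?_⟩
          rintro ⟨n, hn⟩ h1 h2
          exact hml.2 h1 h2
        refine raw_ext_of_rawConn hlim' fun j hj => ?_
        exact congrArg Subtype.val (h ⟨j, hj.trans hl⟩ hj)
      root := by
        refine ⟨⟨0, hc.ord_pos⟩, fun l => show (0 : Ordinal.{u}) ≤ l from zero_le,
          ⟨rawConn k 0 zero_le e, rawConn_mem_members ha zero_le _ he, fun m hm hmk =>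
            hee.rawConn_rawConn _ _⟩⟩ }
  obtain ⟨x, hx⟩ := hD.hasFullBranch ht fun l => lt_of_le_of_lt
    (Cardinal.mk_subtype_mono fun d hd => hd.1) (hsize l (succ_le_of_lt l.2))
  obtain ⟨b, hb, hbl⟩ := exists_isElement_of_compatible hi.isSuccPrelimit
    (fun l hl => (x ⟨l, hl⟩).1) (fun l hl => hel hl (x ⟨l, hl⟩).2.1)
    (fun k l hkl hl => congrArg Subtype.val (hx ⟨k, hkl.trans_lt hl⟩ ⟨l, hl⟩ hkl))
  refine ⟨b, hb, fun l hl => ?_, ?_⟩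
  · rw [hbl l hl]
    exact (x ⟨l, hl⟩).2.1
  · rw [hbl k hk, ← rawConn_self k (x ⟨k, hk⟩).1, (x ⟨k, hk⟩).2.2 k le_rfl le_rfl, rawConn_self]

end Members

/-- Below a weakly compact cardinal the levels are small. -/
theorem mk_raw_lt {c : Cardinal.{u}} (hc : c.IsRegular)
    (hinacc : ∀ A : Type u, Cardinal.mk A < c → Cardinal.mk (Set A) < c) (l : Ordinal.{u}) :
    l < c.ord → Cardinal.mk (Raw l) < Cardinal.lift.{u + 1} c := by
  have hset : ∀ A : Type (u + 1), Cardinal.mk A < Cardinal.lift.{u + 1} c →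
      Cardinal.mk (Set A) < Cardinal.lift.{u + 1} c := by
    intro A hA
    obtain ⟨m, hmA, hm⟩ := Cardinal.lt_lift_iff.1 hA
    rw [Cardinal.mk_set, ← hm, ← Cardinal.lift_two_power, Cardinal.lift_lt]
    have := hinacc m.out (by rwa [Cardinal.mk_out])
    rwa [Cardinal.mk_set, Cardinal.mk_out] at this
  induction l using SuccOrder.prelimitRecOn with
  | succ l _ ih =>
    intro hl
    rw [Cardinal.mk_congr (succEquiv l)]
    exact hset _ (ih ((lt_succ l).trans hl))
  | isSuccPrelimit l hlim ih =>
    intro hl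
    have hsig : Cardinal.mk (Σ m : Set.Iio l, Raw m) < Cardinal.lift.{u + 1} c := by
      rw [Cardinal.mk_sigma]
      refine Cardinal.sum_lt_of_isRegular hc.lift ?_ fun m => ih m m.2 (lt_trans m.2 hl)
      rw [Cardinal.mk_Iio_ordinal, Cardinal.lift_lt]
      exact Cardinal.lt_ord.1 hl
    refine lt_of_le_of_lt ?_ (hset _ hsig)
    -- A tuple is determined by its graph, a subset of the disjoint union of the lower levels. That
    -- union is smaller than `c` by regularity.
    refine Cardinal.mk_le_of_injective (f := fun x : Raw l =>
      {p : Σ m : Set.Iio l, Raw m | limEquiv hlim x p.1 p.1.2 = p.2}) fun x y h => ?_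
    apply (limEquiv hlim).injective
    funext m hm
    have : (⟨⟨m, hm⟩, limEquiv hlim x m hm⟩ : Σ m : Set.Iio l, Raw m) ∈
      {p : Σ m : Set.Iio l, Raw m | limEquiv hlim x p.1 p.1.2 = p.2} := rfl
    rw [show {p : Σ m : Set.Iio l, Raw m | limEquiv hlim x p.1 p.1.2 = p.2} =
      {p : Σ m : Set.Iio l, Raw m | limEquiv hlim y p.1 p.1.2 = p.2} from h] at this
    exact this.symm

/-- The connecting maps down to level `κ` are injective. -/
theorem rawConn_injective_of_regular {c : Cardinal.{u}} (hc : c.IsRegular) (l : Ordinal.{u}) :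
    ∀ (hl : c.ord ≤ l) (x y : Raw l), IsElement (c : WithTop Cardinal.{u}) l x →
      IsElement (c : WithTop Cardinal.{u}) l y →
      rawConn l c.ord hl x = rawConn l c.ord hl y → x = y := by
  have hlim : IsSuccLimit c.ord := Cardinal.isSuccLimit_ord hc.aleph0_le
  induction l using SuccOrder.prelimitRecOn with
  | succ l _ ih =>
    intro hl
    have hcl : c.ord ≤ l := by
      rcases hl.lt_or_eq with h | h
      · exact lt_succ_iff.1 h
      · exact absurd hlim.isSuccPrelimit (h ▸ not_isSuccPrelimit_succ l)
    have hsub : ∀ x y : Raw (succ l), IsElement (c : WithTop Cardinal.{u}) (succ l) x →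
        IsElement (c : WithTop Cardinal.{u}) (succ l) y →
        rawConn (succ l) c.ord hl x = rawConn (succ l) c.ord hl y →
        members x l le_rfl ⊆ members y l le_rfl := by
      intro x y hx hy h b hb
      by_contra hby
      have hbe := isElement_of_mem_members hx _ hb
      -- By the induction hypothesis, each member `d` of `y` is told apart from `b` at some level
      -- below `κ`.
      have hsep : ∀ d : Raw l, ∃ k, d ∈ members y l le_rfl →
          k < c.ord ∧ ∀ hk : k ≤ l, rawConn l k hk b ≠ rawConn l k hk d := by
        intro d
        by_cases hd : d ∈ members y l le_rfl
        · by_contra hno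
          push Not at hno
          refine hby ?_
          have hde := isElement_of_mem_members hy _ hd
          rw [ih hcl b d hbe hde ?_]
          · exact hd
          refine raw_ext_of_rawConn hlim.isSuccPrelimit fun k hk => ?_
          rw [hbe.rawConn_rawConn, hde.rawConn_rawConn]
          obtain ⟨hk', h'⟩ := (hno k).2 hk
          exact h'
        · exact ⟨0, fun h => absurd h hd⟩
      choose k hk using hsep
      -- As `y` has fewer than `κ` members and `κ` is regular, a single level `K < κ` separates `b`
      -- from all of them. But `x` and `y` agree at level `K + 1`, so some member of `y` agrees with
      -- `b` at level `K`.
      have hsup : sSup (k '' members y l le_rfl) < c.ord := by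
        refine Ordinal.sSup_lt_of_lt_cof ?_ ?_
        · rw [← Ordinal.lift_cof, hc.cof_ord]
          exact ((sizeLT_members hy le_rfl).image k).mk_lt
        · rintro _ ⟨d, hd, rfl⟩
          exact (hk d hd).1
      have hbdd : BddAbove (k '' members y l le_rfl) := by
        refine ⟨c.ord, ?_⟩
        rintro _ ⟨d, hd, rfl⟩
        exact (hk d hd).1.le
      generalize hK : sSup (k '' members y l le_rfl) = K at hsup
      have hKl : K ≤ l := hsup.le.trans hcl
      have hmem : members x K (succ_le_succ hKl) = members y K (succ_le_succ hKl) := by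
        have h1 := hx.rawConn_rawConn (succ_le_of_lt hsup) hl
        have h2 := hy.rawConn_rawConn (succ_le_of_lt hsup) hl
        rw [members, members, ← h1, ← h2, h]
      have hbK := rawConn_mem_members hx hKl le_rfl hb
      rw [hmem] at hbK
      obtain ⟨d, hd, hdb⟩ := exists_lift_members hy hKl le_rfl hbK
      have hkK : k d ≤ K := hK ▸ le_csSup hbdd ⟨d, hd, rfl⟩
      refine (hk d hd).2 (hkK.trans hKl) ?_
      rw [← hbe.rawConn_rawConn hkK hKl,
        ← (isElement_of_mem_members hy _ hd).rawConn_rawConn hkK hKl, hdb]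
    intro x y hx hy h
    apply (succEquiv l).injective
    rw [← members_succ_self, ← members_succ_self]
    exact (hsub x y hx hy h).antisymm (hsub y x hy hx h.symm)
  | isSuccPrelimit l hll ih =>
    intro hl x y hx hy h
    refine raw_ext_of_rawConn hll fun k hk => ?_
    rcases le_total c.ord k with hck | hkc
    · refine ih k hk hck _ _ (hx.rawConn _) (hy.rawConn _) ?_
      rw [hx.rawConn_rawConn, hy.rawConn_rawConn, h]
    · rw [← hx.rawConn_rawConn hkc hl, ← hy.rawConn_rawConn hkc hl, h]

/-- Above level `κ` the connecting maps are injective on elements, so lifts of a fixed member at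
level `max k κ` are unique and cohere automatically. -/
theorem exists_branch_of_lt {c : Cardinal.{u}} (hc : c.IsRegular) {i : Ordinal.{u}}
    (hi : IsSuccPrelimit i) (hci : c.ord < i) {a : Raw i}
    (ha : IsElement (c : WithTop Cardinal.{u}) i a) {k : Ordinal.{u}} (hk : k < i) {e : Raw k}
    (he : e ∈ members a k (succ_le_of_lt hk)) :
    ∃ b : Raw i, IsElement (c : WithTop Cardinal.{u}) i b ∧
      (∀ l (hl : l < i), rawConn i l hl.le b ∈ members a l (succ_le_of_lt hl)) ∧
      rawConn i k hk.le b = e := by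
  obtain ⟨e0, he0, hee⟩ := exists_lift_members ha (le_max_left k c.ord)
    (succ_le_of_lt (max_lt hk hci)) he
  have hex : ∀ l, ∃ x : Raw (max l (max k c.ord)), ∀ hl : l < i,
      x ∈ members a _ (succ_le_of_lt (max_lt hl (max_lt hk hci))) ∧
      rawConn _ _ (le_max_right _ _) x = e0 := by
    intro l
    by_cases hl : l < i
    · obtain ⟨x, hx⟩ := exists_lift_members ha (le_max_right l (max k c.ord))
        (succ_le_of_lt (max_lt hl (max_lt hk hci))) he0
      exact ⟨x, fun _ => hx⟩
    -- An arbitrary value for the irrelevant levels `l ≥ i`.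
    · exact ⟨rawProj (fun _ _ : Unit => False) _ (), fun h => absurd h hl⟩
  choose x hx using hex
  have hel : ∀ l, l < i → IsElement (c : WithTop Cardinal.{u}) _ (x l) := fun l hl =>
    isElement_of_mem_members ha _ (hx l hl).1
  obtain ⟨b, hb, hbm, hbl⟩ := exists_branch_of_coherent hi ha (fun l => max l (max k c.ord))
    (fun l => le_max_left _ _) (fun l hl => max_lt hl (max_lt hk hci)) x
    (fun l hl => (hx l hl).1) fun m l hml hl => by
      have hml' : max m (max k c.ord) ≤ max l (max k c.ord) := max_le_max hml le_rfl
      have hm := hml.trans_lt hl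
      rw [← (hel l hl).rawConn_rawConn (le_max_left m (max k c.ord)) hml']
      congr 1
      refine rawConn_injective_of_regular hc _ ((le_max_right _ _).trans (le_max_right _ _))
        _ _ ((hel l hl).rawConn _) (hel m hm) ?_
      rw [(hel l hl).rawConn_rawConn,
        ← (hel l hl).rawConn_rawConn (le_max_right k c.ord) (le_max_right _ _),
        ← (hel m hm).rawConn_rawConn (le_max_right k c.ord) (le_max_right _ _),
        (hx l hl).2, (hx m hm).2]
  refine ⟨b, hb, hbm, ?_⟩
  rw [hbl k hk, ← hee, ← (hx k hk).2, (hel k hk).rawConn_rawConn]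

/-- At an extensible limit every component of a candidate successor extends to a successor. -/
theorem Extensible.exists_branch {κ : WithTop Cardinal.{u}}
    (hκ : ∀ c : Cardinal.{u}, κ = (c : WithTop Cardinal.{u}) → c.IsRegular) {i : Ordinal.{u}}
    (hext : Extensible κ i) (hi : IsSuccPrelimit i) {a : Raw i} (ha : IsElement κ i a)
    {k : Ordinal.{u}} (hk : k < i) {e : Raw k} (he : e ∈ members a k (succ_le_of_lt hk)) :
    ∃ b : Raw i, IsElement κ i b ∧
      (∀ l (hl : l < i), rawConn i l hl.le b ∈ members a l (succ_le_of_lt hl)) ∧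
      rawConn i k hk.le b = e := by
  rcases hext with rfl | hω | ⟨c, hc, rfl⟩ | ⟨c, rfl, -, hci⟩ | ⟨c, rfl, rfl, ht⟩
  · exact absurd hk (not_lt.2 zero_le)
  · exact exists_branch_of_omegaCofinal hi hω ha hk he
  · refine exists_branch_of_treeProperty hc.regular hc.treeProperty ha (fun l hl => ?_) hk he
    exact (Cardinal.mk_subtype_le _).trans_lt
      (mk_raw_lt hc.regular hc.inaccessible l (succ_le_iff.1 hl))
  · refine exists_branch_of_lt (hκ c rfl) hi (lt_of_lt_of_le ?_ hci) ha hk he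
    exact lt_add_of_pos_right _ Ordinal.omega0_pos
  · refine exists_branch_of_treeProperty (hκ c rfl) ht ha (fun l hl => ?_) hk he
    exact (sizeLT_members ha hl).mk_lt

/-! ## Projections of elements of the final chain -/

/-- The projection of an element of the final chain, regarded as a pointed system. -/
noncomputable def chainProj {κ : WithTop Cardinal.{u}} (k : Ordinal.{u}) {i : Ordinal.{u}}
    (a : Raw i) (ha : IsElement κ i a) : Raw k :=
  rawProj ChainStep.{u} k ⟨i, a, ha.top⟩

section ChainProj

variable {κ : WithTop Cardinal.{u}} {i : Ordinal.{u}}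

/-- Transitions are taken in the final chain of the full powerset functor, but a successor of an
element of the smaller chain has all its components in members of that element, so it never leaves
the smaller chain. -/
theorem members_top_isElement {a : Raw i} (ha : IsElement κ i a) (hi : IsSuccPrelimit i)
    {b : Raw i} (hb : IsElement (⊤ : WithTop Cardinal.{u}) i b)
    (h : ∀ l (hl : l < i), rawConn i l hl.le b ∈ members a l (succ_le_of_lt hl)) :
    IsElement κ i b := by
  rw [isElement_limit hi] at hb ⊢
  refine ⟨fun l hl => ?_, hb.2⟩
  rw [limEquiv_eq_rawConn]
  exact isElement_of_mem_members ha _ (h l hl)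

theorem chainProj_succ_succ {a : Raw (succ i)} (ha : IsElement κ (succ i) a) (k : Ordinal.{u}) :
    chainProj (succ k) a ha = (succEquiv k).symm
      {c | ∃ (b : Raw i) (hb : IsElement κ i b), b ∈ members a i le_rfl ∧ chainProj k b hb = c} := by
  rw [chainProj, rawProj_succ]
  congr 1
  ext c
  constructor
  · rintro ⟨y, hy, rfl⟩
    obtain ⟨b, rfl, hb⟩ := chainStep_succ_iff.1 hy
    exact ⟨b.1, isElement_of_mem_members ha _ hb, hb, rfl⟩
  · rintro ⟨b, hb, hm, rfl⟩
    exact ⟨⟨i, b, hb.top⟩, chainStep_succ_iff.2 ⟨_, rfl, hm⟩, rfl⟩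

theorem chainProj_succ_limit (hi : IsSuccPrelimit i) {a : Raw i} (ha : IsElement κ i a)
    (k : Ordinal.{u}) :
    chainProj (succ k) a ha = (succEquiv k).symm
      {c | ∃ (b : Raw i) (hb : IsElement κ i b),
        (∀ l (hl : l < i), rawConn i l hl.le b ∈ members a l (succ_le_of_lt hl)) ∧
          chainProj k b hb = c} := by
  rw [chainProj, rawProj_succ]
  congr 1
  ext c
  constructor
  · rintro ⟨y, hy, rfl⟩
    obtain ⟨b, rfl, hb⟩ := (chainStep_limit_iff hi).1 hy
    exact ⟨b.1, members_top_isElement ha hi b.2 hb, hb, rfl⟩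
  · rintro ⟨b, hb, hm, rfl⟩
    exact ⟨⟨i, b, hb.top⟩, (chainStep_limit_iff hi).2 ⟨_, rfl, hm⟩, rfl⟩

theorem rawConn_chainProj {a : Raw i} (ha : IsElement κ i a) {j k : Ordinal.{u}} (h : j ≤ k) :
    rawConn k j h (chainProj k a ha) = chainProj j a ha := rawConn_rawProj _ _ _ _ _

end ChainProj

/-- Elements are their own projections, when the limit part is extensible or the projection goes to
a finite level at most the finite part. -/
theorem chainProj_eq_rawConn {κ : WithTop Cardinal.{u}}
    (hκ : ∀ c : Cardinal.{u}, κ = (c : WithTop Cardinal.{u}) → c.IsRegular) (k : Ordinal.{u}) :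
    ∀ (i : Ordinal.{u}) (h : k ≤ i), (k ≤ finitePart i ∨ Extensible κ (limitPart i)) →
      ∀ (a : Raw i) (ha : IsElement κ i a), chainProj k a ha = rawConn i k h a := by
  induction k using SuccOrder.prelimitRecOn with
  | succ k _ ih =>
    intro i h hq a ha
    rw [rawConn_succ_eq_members]
    by_cases hi : IsSuccPrelimit i
    · rw [finitePart_of_isSuccPrelimit hi, limitPart_of_isSuccPrelimit hi] at hq
      -- The finite part of a limit is `0`, which rules out the first alternative for a successor
      -- `k`.
      have hext : Extensible κ i := hq.resolve_left fun h0 =>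
        absurd h0 (not_le.2 ((zero_le (a := k)).trans_lt (lt_succ k)))
      have hki := succ_le_iff.1 h
      rw [chainProj_succ_limit hi]
      congr 1
      ext e
      constructor
      · rintro ⟨b, hb, hm, rfl⟩
        rw [ih i hki.le (Or.inr (by rwa [limitPart_of_isSuccPrelimit hi])) b hb]
        exact hm k hki
      · intro he
        obtain ⟨b, hb, hm, hbe⟩ := hext.exists_branch hκ hi ha hki he
        refine ⟨b, hb, hm, ?_⟩
        rw [ih i hki.le (Or.inr (by rwa [limitPart_of_isSuccPrelimit hi])) b hb, hbe]
    · obtain ⟨i, rfl⟩ : ∃ i', succ i' = i := by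
        exact not_isSuccPrelimit_iff_mem_range_succ.1 hi
      -- Passing to members lowers `k` and the finite part of `i` by one each and keeps the limit
      -- part, so both alternatives are inherited.
      rw [finitePart_succ, limitPart_succ, succ_le_succ_iff] at hq
      have hki : k ≤ i := succ_le_succ_iff.1 h
      rw [chainProj_succ_succ, ← members_image ha hki le_rfl]
      congr 1
      ext e
      constructor
      · rintro ⟨b, hb, hm, rfl⟩
        exact ⟨b, hm, (ih i hki hq b hb).symm⟩
      · rintro ⟨b, hm, rfl⟩
        have hb := isElement_of_mem_members ha _ hm
        exact ⟨b, hb, hm, ih i hki hq b hb⟩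
  | isSuccPrelimit k hk ih =>
    intro i h hq a ha
    refine raw_ext_of_rawConn hk fun l hl => ?_
    rw [rawConn_chainProj, ha.rawConn_rawConn]
    exact ih l hl i _ (hq.imp_left fun h => hl.le.trans h) a ha

theorem extensible_zero (κ : WithTop Cardinal.{u}) : Extensible κ 0 := Or.inl rfl

/-! ## Finite chains -/

/-- The transition relation on `ℕ` with `n + 1 ⇝ n`. -/
def countdown (a b : ULift.{u} ℕ) : Prop := a.down = b.down + 1

/-- The projection of the number `m`, regarded as a chain of `m` transitions. -/
noncomputable def natProj (k : Ordinal.{u}) (m : ℕ) : Raw k := rawProj countdown.{u} k ⟨m⟩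

theorem natProj_zero_succ (k : Ordinal.{u}) :
    natProj (succ k) 0 = (succEquiv k).symm ∅ := by
  rw [natProj, rawProj_succ]
  congr 1
  rw [Set.image_eq_empty, Set.eq_empty_iff_forall_notMem]
  intro y (hy : 0 = y.down + 1)
  omega

theorem natProj_succ_succ (k : Ordinal.{u}) (m : ℕ) :
    natProj (succ k) (m + 1) = (succEquiv k).symm {natProj k m} := by
  rw [natProj, rawProj_succ]
  congr 1
  rw [natProj, ← Set.image_singleton]
  congr 1
  ext y
  constructor
  · intro (hy : m + 1 = y.down + 1)
    exact ULift.ext _ _ (show y.down = m by omega)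
  · rintro rfl
    rfl

theorem rawConn_natProj {j k : Ordinal.{u}} (h : j ≤ k) (m : ℕ) :
    rawConn k j h (natProj k m) = natProj j m := rawConn_rawProj _ _ _ _ _

/-- The pointed system `m ⇝ m - 1 ⇝ ⋯ ⇝ 0`. -/
def natSystem (m : ℕ) : PointedSystem.{u} := ⟨ULift ℕ, countdown, ⟨m⟩⟩

theorem natSystem_branching {κ : WithTop Cardinal.{u}}
    (hκ : ∀ c : Cardinal.{u}, κ = (c : WithTop Cardinal.{u}) → c.IsRegular) (m : ℕ) :
    (natSystem.{u} m).Branching κ := by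
  refine fun y _ => SizeLT.of_subsingleton hκ fun a (ha : y.down = _) b (hb : y.down = _) => ?_
  exact ULift.ext _ _ (by omega)

theorem isElement_natProj {κ : WithTop Cardinal.{u}}
    (hκ : ∀ c : Cardinal.{u}, κ = (c : WithTop Cardinal.{u}) → c.IsRegular) (k : Ordinal.{u})
    (m : ℕ) : IsElement κ k (natProj k m) :=
  isElement_rawProj _ _ _ (natSystem_branching hκ m)

theorem members_natProj_zero {i k : Ordinal.{u}} (hk : succ k ≤ i) :
    members (natProj i 0) k hk = ∅ := by
  rw [members, rawConn_natProj, natProj_zero_succ, Equiv.apply_symm_apply]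

theorem members_natProj_succ {i k : Ordinal.{u}} (hk : succ k ≤ i) (m : ℕ) :
    members (natProj i (m + 1)) k hk = {natProj k m} := by
  rw [members, rawConn_natProj, natProj_succ_succ, Equiv.apply_symm_apply]

/-- No extensibility is needed: the sets of members are empty or singletons, so at a limit there is
no branch, or exactly one. The bound `k ≤ i` matters, since at level `0` the unique element is its
own successor. -/
theorem chainProj_natProj {κ : WithTop Cardinal.{u}}
    (hκ : ∀ c : Cardinal.{u}, κ = (c : WithTop Cardinal.{u}) → c.IsRegular) (k : Ordinal.{u}) :
    ∀ (i : Ordinal.{u}) (_ : k ≤ i) (m : ℕ),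
      chainProj k (natProj i m) (isElement_natProj hκ i m) = natProj k m := by
  induction k using SuccOrder.prelimitRecOn with
  | succ k _ ih =>
    intro i h m
    by_cases hi : IsSuccPrelimit i
    · have hki := succ_le_iff.1 h
      rw [chainProj_succ_limit hi]
      cases m with
      | zero =>
        rw [natProj_zero_succ]
        congr 1
        rw [Set.eq_empty_iff_forall_notMem]
        rintro _ ⟨b, hb, hm, -⟩
        have := hm k hki
        rw [members_natProj_zero] at this
        exact this
      | succ m =>
        rw [natProj_succ_succ]
        congr 1
        ext e
        constructor
        · rintro ⟨b, hb, hm, rfl⟩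
          have : b = natProj i m := by
            refine raw_ext_of_rawConn hi fun l hl => ?_
            have := hm l hl
            rw [members_natProj_succ] at this
            rw [rawConn_natProj]
            exact this
          subst this
          exact ih i hki.le m
        · rintro rfl
          refine ⟨natProj i m, isElement_natProj hκ i m, fun l hl => ?_, ih i hki.le m⟩
          rw [members_natProj_succ, rawConn_natProj]
          rfl
    · obtain ⟨i, rfl⟩ : ∃ i', succ i' = i := by
        exact not_isSuccPrelimit_iff_mem_range_succ.1 hi
      have hki : k ≤ i := succ_le_succ_iff.1 h
      rw [chainProj_succ_succ]
      cases m with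
      | zero =>
        rw [natProj_zero_succ k, members_natProj_zero]
        congr 1
        rw [Set.eq_empty_iff_forall_notMem]
        rintro _ ⟨b, hb, hm, -⟩
        exact hm
      | succ m =>
        rw [natProj_succ_succ k, members_natProj_succ]
        congr 1
        ext e
        constructor
        · rintro ⟨b, hb, rfl, rfl⟩
          exact ih i hki m
        · rintro rfl
          exact ⟨natProj i m, isElement_natProj hκ i m, rfl, ih i hki m⟩
  | isSuccPrelimit k hk ih =>
    intro i h m
    refine raw_ext_of_rawConn hk fun l hl => ?_
    rw [rawConn_chainProj, rawConn_natProj]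
    exact ih l hl i (hl.le.trans h) m

/-- If the limit part of `i` is not extensible, with `m` the finite part, then there is an element
at level `i` that is bisimilar to the chain of length `m` without being its projection. -/
theorem exists_fake_nat {κ : WithTop Cardinal.{u}}
    (hκ : ∀ c : Cardinal.{u}, κ = (c : WithTop Cardinal.{u}) → c.IsRegular) (m : ℕ) :
    ∀ i : Ordinal.{u}, finitePart i = m → ¬ Extensible κ (limitPart i) →
      ∃ (a : Raw i) (ha : IsElement κ i a), (∀ k, chainProj k a ha = natProj k m) ∧
        ∀ k (hk : k ≤ i), (m : Ordinal.{u}) < k → rawConn i k hk a ≠ natProj k m := by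
  -- It suffices to separate the two at level `m + 1`, because elements that differ at one level
  -- differ at every higher level.
  suffices H : ∀ i : Ordinal.{u}, finitePart i = m → ¬ Extensible κ (limitPart i) →
      ∃ (a : Raw i) (ha : IsElement κ i a), (∀ k, chainProj k a ha = natProj k m) ∧
        ∀ k (hk : succ k ≤ i), k = m → rawConn i (succ k) hk a ≠ natProj _ m by
    intro i hi hext
    obtain ⟨a, ha, h1, h2⟩ := H i hi hext
    refine ⟨a, ha, h1, fun k hk hmk h => h2 m ((succ_le_of_lt hmk).trans hk) rfl ?_⟩
    rw [← ha.rawConn_rawConn (succ_le_of_lt hmk) hk, h, rawConn_natProj]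
  induction m with
  | zero =>
    intro i hi hext
    have hlim : IsSuccPrelimit i := by
      rw [eq_limitPart_add hi, Nat.cast_zero, add_zero]
      exact isSuccPrelimit_limitPart i
    rw [limitPart_of_isSuccPrelimit hlim] at hext
    -- A ghost has no successors, so all its projections are those of a deadlock, while its
    -- component at level `1` is nonempty.
    obtain ⟨-, t, ht, hne, hno⟩ := exists_ghost hκ hlim hext
    refine ⟨t, ht, fun k => ?_, fun k hk _ h => ?_⟩
    · induction k using SuccOrder.prelimitRecOn with
      | succ k _ _ =>
        rw [chainProj_succ_limit hlim, natProj_zero_succ]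
        congr 1
        rw [Set.eq_empty_iff_forall_notMem]
        rintro _ ⟨b, hb, hm, -⟩
        exact hno b hb.top hm
      | isSuccPrelimit k hk ih =>
        refine raw_ext_of_rawConn hk fun l hl => ?_
        rw [rawConn_chainProj, rawConn_natProj, ih l hl]
    · have := hne _ hk
      rw [members, h, natProj_zero_succ, Equiv.apply_symm_apply] at this
      exact Set.not_nonempty_empty this
  | succ m ihm =>
    intro i hi hext
    obtain ⟨i, rfl⟩ : ∃ i', succ i' = i := by
      refine ⟨limitPart i + m, ?_⟩
      conv_rhs => rw [eq_limitPart_add hi]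
      rw [Order.succ_eq_add_one, Nat.cast_succ, add_assoc]
    rw [finitePart_succ, Nat.cast_succ, ← Order.succ_eq_add_one] at hi
    replace hi := succ_injective hi
    rw [limitPart_succ] at hext
    obtain ⟨a, ha, h1, h2⟩ := ihm i hi hext
    -- The singleton of the previous fake adds one transition and moves the separating level up by
    -- one.
    have hmem : members ((succEquiv i).symm {a}) i le_rfl = {a} := by
      rw [members_succ_self, Equiv.apply_symm_apply]
    have ha' : IsElement κ (succ i) ((succEquiv i).symm {a}) := by
      rw [isElement_succ, Equiv.apply_symm_apply]
      refine ⟨SizeLT.of_subsingleton hκ Set.subsingleton_singleton, ?_⟩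
      rintro _ rfl
      exact ha
    refine ⟨(succEquiv i).symm {a}, ha', fun k => ?_, fun k hk hkm h => ?_⟩
    · induction k using SuccOrder.prelimitRecOn with
      | succ k _ _ =>
        rw [chainProj_succ_succ, natProj_succ_succ, hmem]
        congr 1
        ext e
        constructor
        · rintro ⟨b, hb, rfl, rfl⟩
          exact h1 k
        · rintro rfl
          exact ⟨a, ha, rfl, h1 k⟩
      | isSuccPrelimit k hk ih =>
        refine raw_ext_of_rawConn hk fun l hl => ?_
        rw [rawConn_chainProj, rawConn_natProj, ih l hl]
    · rw [Nat.cast_succ, ← Order.succ_eq_add_one] at hkm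
      subst hkm
      have hk' := succ_le_succ_iff.1 hk
      rw [natProj_succ_succ, rawConn_succ_eq_members, Equiv.apply_eq_iff_eq,
        ← members_image ha' hk' le_rfl, hmem, Set.image_singleton] at h
      exact h2 _ hk' rfl (Set.singleton_injective h)

end GhostChain

/-! ### The two equivalences -/

theorem proposition7p15 (κ : WithTop Cardinal.{u})
    (hκ : ∀ c : Cardinal.{u}, κ = (c : WithTop Cardinal.{u}) → c.IsRegular) :
    (∀ j : Ordinal.{u}, List.TFAE [
      -- any `b` with `b ∼ⱼ x` is `pⱼ(x)`
      ∀ (x : GhostChain.PointedSystem.{u}) (hx : x.Branching κ)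
        (b : (GhostChain.finalChain κ).level j),
        (GhostChain.toSystem b).Sim j x → b = x.proj j hx,
      -- `pⱼ(x)` is the unique `b` with `b ∼ⱼ x`
      ∀ (x : GhostChain.PointedSystem.{u}) (hx : x.Branching κ),
        (GhostChain.toSystem (x.proj j hx)).Sim j x ∧
        ∀ b : (GhostChain.finalChain κ).level j,
          (GhostChain.toSystem b).Sim j x → b = x.proj j hx,
      GhostChain.Extensible κ (GhostChain.limitPart j)]) ∧
    (∀ (j i : Ordinal.{u}) (hji : j ≤ i), List.TFAE [
      -- any `b` with `b ∼ⱼ a` is `νʲᵢ a`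
      ∀ (a : (GhostChain.finalChain κ).level i) (b : (GhostChain.finalChain κ).level j),
        (GhostChain.toSystem b).Sim j (GhostChain.toSystem a) →
          b = (GhostChain.finalChain κ).map hji a,
      -- `νʲᵢ a` is the unique `b` with `b ∼ⱼ a`
      ∀ a : (GhostChain.finalChain κ).level i,
        (GhostChain.toSystem ((GhostChain.finalChain κ).map hji a)).Sim j
          (GhostChain.toSystem a) ∧
        ∀ b : (GhostChain.finalChain κ).level j,
          (GhostChain.toSystem b).Sim j (GhostChain.toSystem a) →
            b = (GhostChain.finalChain κ).map hji a,
      j ≤ GhostChain.finitePart i ∨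
        (GhostChain.Extensible κ (GhostChain.limitPart j) ∧
          GhostChain.Extensible κ (GhostChain.limitPart i))]) := by
  open GhostChain in
  have hself : ∀ (j : Ordinal.{u}), Extensible κ (limitPart j) → ∀ (b : (finalChain κ).level j),
      chainProj j b.1 b.2 = b.1 := fun j hj b =>
    (chainProj_eq_rawConn hκ j j le_rfl (Or.inr hj) b.1 b.2).trans (rawConn_self j b.1)
  have hsim : ∀ {i j : Ordinal.{u}} (b : (finalChain κ).level j) (a : (finalChain κ).level i),
      (toSystem b).Sim j (toSystem a) ↔ chainProj j b.1 b.2 = chainProj j a.1 a.2 := fun b a =>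
    (rawProj_eq_iff_approx _ _ _ _ _).symm
  have hsim' : ∀ {j : Ordinal.{u}} (b : (finalChain κ).level j) (x : PointedSystem.{u}),
      (toSystem b).Sim j x ↔ chainProj j b.1 b.2 = rawProj x.step j x.pt := fun b x =>
    (rawProj_eq_iff_approx _ _ _ _ _).symm
  constructor
  · intro j
    tfae_have 3 → 2 := by
      intro hj x hx
      refine ⟨(hsim' _ _).2 (hself j hj _), fun b hb => Subtype.ext ?_⟩
      rw [← hself j hj b]
      exact (hsim' _ _).1 hb
    tfae_have 2 → 1 := fun h x hx => (h x hx).2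
    tfae_have 1 → 3 := by
      intro h
      by_contra hj
      obtain ⟨m, hm⟩ := exists_finitePart_eq j
      obtain ⟨a, ha, h1, h2⟩ := exists_fake_nat hκ m j hm hj
      -- Otherwise `j` is finite, and its limit part `0` is extensible.
      have hmj : (m : Ordinal.{u}) < j := by
        refine lt_of_not_ge fun hle => hj ?_
        rw [limitPart_eq_zero_of_lt_omega0 (hle.trans_lt (Ordinal.natCast_lt_omega0 m))]
        exact extensible_zero κ
      have := h (natSystem m) (natSystem_branching hκ m) ⟨a, ha⟩ ((hsim' _ _).2 (h1 j))
      refine h2 j le_rfl hmj ?_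
      rw [rawConn_self]
      exact congrArg Subtype.val this
    tfae_finish
  · intro j i hji
    tfae_have 3 → 2 := by
      intro hq a
      have hj : Extensible κ (limitPart j) := by
        -- In the first alternative `j` is finite, so its limit part is `0`.
        rcases hq with hq | hq
        · obtain ⟨m, hm⟩ := exists_finitePart_eq i
          rw [limitPart_eq_zero_of_lt_omega0
            (hq.trans_lt (hm ▸ Ordinal.natCast_lt_omega0 m))]
          exact extensible_zero κ
        · exact hq.1
      have ha : chainProj j a.1 a.2 = rawConn i j hji a.1 :=
        chainProj_eq_rawConn hκ j i hji (hq.imp_right And.right) a.1 a.2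
      refine ⟨(hsim _ _).2 ((hself j hj _).trans ha.symm), fun b hb => Subtype.ext ?_⟩
      rw [← hself j hj b]
      exact ((hsim _ _).1 hb).trans ha
    tfae_have 2 → 1 := fun h a => (h a).2
    tfae_have 1 → 3 := by
      intro h
      by_contra hq
      push Not at hq
      obtain ⟨hlt, hq⟩ := hq
      -- The fake is put at the level whose limit part fails to be extensible: as `a` at level `i`,
      -- against the genuine chain `b`, or as `b` at level `j`, against the genuine chain `a`. In
      -- the first case the fake remains distinguishable at level `j` because `j` exceeds the finite
      -- part of `i`.
      by_cases hj : Extensible κ (limitPart j)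
      · obtain ⟨m, hm⟩ := exists_finitePart_eq i
        obtain ⟨a, ha, h1, h2⟩ := exists_fake_nat hκ m i hm (hq hj)
        have := h ⟨a, ha⟩ ⟨natProj j m, isElement_natProj hκ j m⟩
          ((hsim _ _).2 ((chainProj_natProj hκ j j le_rfl m).trans (h1 j).symm))
        exact h2 j hji (hm ▸ hlt) (congrArg Subtype.val this).symm
      · obtain ⟨m, hm⟩ := exists_finitePart_eq j
        obtain ⟨b, hb, h1, h2⟩ := exists_fake_nat hκ m j hm hj
        have hmj : (m : Ordinal.{u}) < j := by
          refine lt_of_not_ge fun hle => hj ?_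
          rw [limitPart_eq_zero_of_lt_omega0 (hle.trans_lt (Ordinal.natCast_lt_omega0 m))]
          exact extensible_zero κ
        have := h ⟨natProj i m, isElement_natProj hκ i m⟩ ⟨b, hb⟩
          ((hsim _ _).2 ((h1 j).trans (chainProj_natProj hκ j i hji m).symm))
        refine h2 j le_rfl hmj ?_
        rw [rawConn_self]
        exact (congrArg Subtype.val this).trans (rawConn_natProj hji m)
    tfae_finish
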